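/- Let $K$ be an algebraically closed field of characteristic $0$ and let $i\in K$ be a primitive fourth root of unity. Let $\mathrm{Rat}_2^2\cong\mathbb P^{17}$ be the space of triples $f=[f_0,f_1,f_2]\ne 0$ of quadratic forms in $X,Y,Z$ over $K$ up to scaling, viewed as rational self-maps of $\mathbb P^2$; the group $\mathrm{PGL}_3(K)$ acts on it by $f^\varphi=\varphi^{-1}\circ f\circ\varphi$, and $\mathrm{Aut}(f)=\{\varphi\in\mathrm{PGL}_3(K): f^\varphi=f\}$. Such an $f$ has degree $2$ if $f_0,f_1,f_2$ have no non-constant common factor. Let $\mathcal G_4\subset\mathrm{PGL}_3(K)$ be the cyclic group of order $4$ generated by the class of $\mathrm{diag}(1,i,-1)$, let $N(\mathcal G_4)$ be its normalizer in $\mathrm{PGL}_3(K)$, let $\tilde{\mathcal G}_4=\langle\mathrm{diag}(-i,1,i)\rangle\subset\mathrm{SL}_3(K)$ be the lift of $\mathcal G_4$ to an isomorphic subgroup of $\mathrm{SL}_3(K)$, and let $N(\tilde{\mathcal G}_4)$ be the normalizer of $\tilde{\mathcal G}_4$ in $\mathrm{SL}_3(K)$. Let $\tilde f\in K^{18}\smallsetminus\{0\}$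 be a lift of $f$. We call $f$ $N(\mathcal G_4)$-semistable if the Zariski closure of the orbit $N(\tilde{\mathcal G}_4)\cdot\tilde f$ does not contain $0$, and $N(\mathcal G_4)$-stable if this orbit is Zariski closed and the stabilizer of $\tilde f$ in $N(\tilde{\mathcal G}_4)$ is finite. Let $\mathrm{Rat}_2^2(\mathcal G_4)^{\mathrm{ss}}$ be the set of $N(\mathcal G_4)$-semistable $f$ with $\mathcal G_4\subseteq\mathrm{Aut}(f)$. Two maps $f,f'$ are $N(\mathcal G_4)$-conjugate if $f'=f^\varphi$ for some $\varphi\in N(\mathcal G_4)$. Let $f\in\mathrm{Rat}_2^2(\mathcal G_4)^{\mathrm{ss}}$ be a dominant map of degree $2$ with $\mathrm{Aut}(f)$ finite. Then $f$ is $N(\mathcal G_4)$-stable, and one of the following holds. (a) $f$ is $N(\mathcal G_4)$-conjugate to a map of the form $f_{a,e}=[aX^2+Z^2,\,XY,\,Y^2+eXZ]$ with $a,e\in K$. (b) $f$ is $N(\mathcal G_4)$-conjugate to a map of the form $f_c=[YZ,\,X^2+cZ^2,\,XY]$ with $c\in K\smallsetminus\{-1\}$. Moreover, $\mathrm{Aut}(f_{a,e})=\mathcal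 G_4$ for all $a,e\in K$, and two maps $f_{a,e}$ and $f_{a',e'}$ are $N(\mathcal G_4)$-conjugate if and only if $(a,e)=(a',e')$. For $c\in K$ with $c\neq\pm1$ we have $\mathrm{Aut}(f_c)=\mathcal G_4$, and for $c=1$ we have $\mathrm{Aut}(f_1)\cong S_4$. For $c,c'\in K\smallsetminus\{-1\}$, the maps $f_c$ and $f_{c'}$ are $N(\mathcal G_4)$-conjugate if and only if $c=c'$ or $cc'=1$. -/

import Mathlib

open scoped LinearAlgebra.Projectivization MatrixGroups

noncomputable section

namespace QuadraticMaps

/-- Triples `(F₀, F₁, F₂)` of quadratic forms in three variables `X = X 0`, `Y = X 1`, `Z = X 2`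
(the zero triple included); a vector space of dimension 18. -/
def Triple (K : Type*) [Field K] : Type _ :=
  Fin 3 → MvPolynomial.homogeneousSubmodule (Fin 3) K 2

instance (K : Type*) [Field K] : AddCommGroup (Triple K) :=
  inferInstanceAs (AddCommGroup (Fin 3 → MvPolynomial.homogeneousSubmodule (Fin 3) K 2))

instance (K : Type*) [Field K] : Module K (Triple K) :=
  inferInstanceAs (Module K (Fin 3 → MvPolynomial.homogeneousSubmodule (Fin 3) K 2))

/-- The `i`-th coordinate polynomial of a triple. -/
def Triple.coord {K : Type*} [Field K] (F : Triple K) (i : Fin 3) : MvPolynomial (Fin 3) K :=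
  (F i : MvPolynomial (Fin 3) K)

theorem Triple.ext_coord {K : Type*} [Field K] {F F' : Triple K}
    (h : ∀ i, F.coord i = F'.coord i) : F = F' :=
  funext fun i => Subtype.ext (h i)

theorem Triple.coord_add {K : Type*} [Field K] (F F' : Triple K) (i : Fin 3) :
    (F + F').coord i = F.coord i + F'.coord i := rfl

theorem Triple.coord_smul {K : Type*} [Field K] (c : K) (F : Triple K) (i : Fin 3) :
    (c • F).coord i = c • F.coord i := rfl

theorem Triple.coord_zero {K : Type*} [Field K] (i : Fin 3) :
    (0 : Triple K).coord i = 0 := rfl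

/-- The triple with given homogeneous coordinate polynomials. -/
def Triple.of {K : Type*} [Field K] (P : Fin 3 → MvPolynomial (Fin 3) K)
    (h : ∀ i, (P i).IsHomogeneous 2) : Triple K :=
  fun i => ⟨P i, (MvPolynomial.mem_homogeneousSubmodule 2 (P i)).2 (h i)⟩

theorem Triple.coord_of {K : Type*} [Field K] (P : Fin 3 → MvPolynomial (Fin 3) K)
    (h : ∀ i, (P i).IsHomogeneous 2) (i : Fin 3) : (Triple.of P h).coord i = P i := rfl

theorem Triple.coord_isHomogeneous {K : Type*} [Field K] (F : Triple K) (i : Fin 3) :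
    (F.coord i).IsHomogeneous 2 :=
  (MvPolynomial.mem_homogeneousSubmodule 2 _).1 (F i).2

/-- The coordinates of `g ∘ F ∘ g⁻¹`. -/
def conjCoord {K : Type*} [Field K] (g : GL (Fin 3) K) (F : Triple K) (i : Fin 3) :
    MvPolynomial (Fin 3) K :=
  ∑ j, (g : Matrix (Fin 3) (Fin 3) K) i j •
    MvPolynomial.bind₁ ((g⁻¹ : GL (Fin 3) K) : Matrix (Fin 3) (Fin 3) K).toMvPolynomial (F.coord j)

theorem conjCoord_isHomogeneous {K : Type*} [Field K] (g : GL (Fin 3) K) (F : Triple K)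
    (i : Fin 3) : (conjCoord g F i).IsHomogeneous 2 := by
  refine MvPolynomial.IsHomogeneous.sum _ _ _ fun j _ => ?_
  rw [MvPolynomial.smul_eq_C_mul]
  have h := (F.coord_isHomogeneous j).aeval
    ((g⁻¹ : GL (Fin 3) K) : Matrix (Fin 3) (Fin 3) K).toMvPolynomial
    (fun k => Matrix.toMvPolynomial_isHomogeneous _ k)
  simpa using (MvPolynomial.isHomogeneous_C (Fin 3) _).mul h

/-- `GL₃` acts linearly on triples (self-maps of affine 3-space) by `g • F = g ∘ F ∘ g⁻¹`. -/
instance (K : Type*) [Field K] : DistribMulAction (GL (Fin 3) K) (Triple K) where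
  smul g F := Triple.of (conjCoord g F) (conjCoord_isHomogeneous g F)
  one_smul F := by
    refine Triple.ext_coord fun i => ?_
    change conjCoord 1 F i = _
    simp [conjCoord, Matrix.one_apply]
  mul_smul g h F := by
    refine Triple.ext_coord fun i => ?_
    change conjCoord (g * h) F i = conjCoord g (Triple.of (conjCoord h F) _) i
    have key : ∀ p : MvPolynomial (Fin 3) K,
        MvPolynomial.bind₁ ((g * h)⁻¹ : GL (Fin 3) K).1.toMvPolynomial p =
          MvPolynomial.bind₁ (g⁻¹ : GL (Fin 3) K).1.toMvPolynomial
            (MvPolynomial.bind₁ (h⁻¹ : GL (Fin 3) K).1.toMvPolynomial p) := by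
      intro p
      rw [MvPolynomial.bind₁_bind₁]
      congr 2
      funext k
      rw [mul_inv_rev, Units.val_mul, Matrix.toMvPolynomial_mul]
    simp only [conjCoord, Triple.coord_of, key, map_sum, map_smul, Units.val_mul,
      Matrix.mul_apply, Finset.sum_smul, Finset.smul_sum, smul_smul]
    exact Finset.sum_comm
  smul_zero g := by
    refine Triple.ext_coord fun i => ?_
    change conjCoord g 0 i = _
    simp [conjCoord, Triple.coord_zero]
  smul_add g F F' := by
    refine Triple.ext_coord fun i => ?_
    change conjCoord g (F + F') i = conjCoord g F i + conjCoord g F' i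
    simp [conjCoord, Triple.coord_add, Finset.sum_add_distrib]

theorem Triple.coord_gl_smul {K : Type*} [Field K] (g : GL (Fin 3) K) (F : Triple K) (i : Fin 3) :
    (g • F).coord i = conjCoord g F i := rfl

instance (K : Type*) [Field K] : SMulCommClass (GL (Fin 3) K) K (Triple K) where
  smul_comm g c F := by
    refine Triple.ext_coord fun i => ?_
    simp [Triple.coord_gl_smul, conjCoord, Triple.coord_smul, Finset.smul_sum, smul_comm c]

/-- The parameter space `ℙ¹⁷` of rational self-maps of the projective plane of formal degree 2:
nonzero triples of quadratic forms up to scaling. -/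
abbrev Rat22 (K : Type*) [Field K] : Type _ := ℙ K (Triple K)

theorem scalar_smul_triple {K : Type*} [Field K] (u : Kˣ) (F : Triple K) :
    Matrix.GeneralLinearGroup.scalar (Fin 3) u • F = (u⁻¹ : Kˣ) • F := by
  refine Triple.ext_coord fun i => ?_
  have hX : ((Matrix.GeneralLinearGroup.scalar (Fin 3) u)⁻¹ : GL (Fin 3) K).1.toMvPolynomial =
      fun k => MvPolynomial.C ((u⁻¹ : Kˣ) : K) * MvPolynomial.X k := by
    funext k
    rw [← map_inv, Matrix.GeneralLinearGroup.coe_scalar]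
    simp only [Matrix.toMvPolynomial, Matrix.scalar_apply, Matrix.diagonal_apply,
      ← MvPolynomial.C_mul_X_eq_monomial]
    rw [Finset.sum_eq_single k]
    · simp
    · intro j _ hj
      simp [hj.symm]
    · simp
  have hs : ∀ q : MvPolynomial (Fin 3) K, q.IsHomogeneous 2 →
      MvPolynomial.bind₁ (fun k => MvPolynomial.C ((u⁻¹ : Kˣ) : K) * MvPolynomial.X k) q =
        (((u⁻¹ : Kˣ) : K) ^ 2) • q := by
    intro q hq
    conv_lhs => rw [q.as_sum]
    conv_rhs => rw [q.as_sum]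
    rw [map_sum, Finset.smul_sum]
    refine Finset.sum_congr rfl fun d hd => ?_
    have hdeg : d.degree = 2 := by
      have := hq (MvPolynomial.mem_support_iff.1 hd)
      rw [Finsupp.degree_eq_weight_one]
      exact this
    rw [MvPolynomial.bind₁_monomial]
    simp only [mul_pow, Finset.prod_mul_distrib]
    rw [MvPolynomial.monomial_eq, MvPolynomial.smul_eq_C_mul, Finset.prod_pow_eq_pow_sum]
    have : ∑ k ∈ d.support, d k = 2 := hdeg
    rw [this, ← MvPolynomial.C_pow]
    simp only [Finsupp.prod]
    ring
  have hc : ((u⁻¹ : Kˣ) • F).coord i = ((u⁻¹ : Kˣ) : K) • F.coord i := rfl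
  rw [hc, Triple.coord_gl_smul, conjCoord, hX]
  simp only [hs _ (F.coord_isHomogeneous _), Matrix.GeneralLinearGroup.coe_scalar]
  rw [Finset.sum_eq_single i]
  · rw [smul_smul]
    congr 1
    have hu : (u : K) ≠ 0 := u.ne_zero
    simp only [Matrix.scalar_apply, Matrix.diagonal_apply_eq, Units.val_inv_eq_inv_val]
    field_simp
  · intro j _ hj
    simp [Matrix.scalar_apply, Matrix.diagonal_apply_ne' _ hj]
  · simp

/-- The action of `PGL₃` on the parameter space by `φ • f = φ ∘ f ∘ φ⁻¹`. -/
instance (K : Type*) [Field K] : MulAction (PGL(3, K)) (Rat22 K) :=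
  Matrix.ProjGenLinGroup.mulActionOfGL fun u => Projectivization.ind fun F hF => by
    rw [Projectivization.smul_mk, Projectivization.mk_eq_mk_iff]
    exact ⟨u⁻¹, (scalar_smul_triple u F).symm⟩

/-- The conjugate `f ^ φ = φ⁻¹ ∘ f ∘ φ`. -/
def conj {K : Type*} [Field K] (f : Rat22 K) (φ : PGL(3, K)) : Rat22 K := φ⁻¹ • f

/-- The automorphism group of `f`: all `φ` in `PGL₃` with `f ^ φ = f`. -/
def Aut {K : Type*} [Field K] (f : Rat22 K) : Subgroup (PGL(3, K)) where
  carrier := {φ | conj f φ = f}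
  one_mem' := by simp [conj]
  mul_mem' {a b} ha hb := by
    simp only [conj, Set.mem_ofPred_eq] at ha hb ⊢
    rw [mul_inv_rev, mul_smul, ha, hb]
  inv_mem' {a} ha := by
    simp only [conj, Set.mem_ofPred_eq, inv_inv] at ha ⊢
    exact (inv_smul_eq_iff.1 ha).symm

/-- The forms have no nonconstant common factor, i.e. `f` has degree exactly 2. -/
def HasDegreeTwo {K : Type*} [Field K] (f : Rat22 K) : Prop :=
  ∀ g : MvPolynomial (Fin 3) K, (∀ i, g ∣ f.rep.coord i) → IsUnit g

/-- The value of a triple at a point of affine 3-space. -/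
def Triple.eval {K : Type*} [Field K] (F : Triple K) (v : Fin 3 → K) : Fin 3 → K :=
  fun i => MvPolynomial.eval v (F.coord i)

/-- The image of `f` is Zariski dense in the projective plane: no nonzero form vanishes at all the
values of `f` at points where its three coordinates do not vanish simultaneously. (To be used over
algebraically closed fields.) -/
def IsDominant {K : Type*} [Field K] (f : Rat22 K) : Prop :=
  ∀ (m : ℕ) (G : MvPolynomial (Fin 3) K), G.IsHomogeneous m →
    (∀ v : Fin 3 → K, f.rep.eval v ≠ 0 → MvPolynomial.eval (f.rep.eval v) G = 0) → G = 0

/-- The Zariski closure of a subset of a finite-dimensional vector space, whose polynomial functions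
are the polynomials in linear functionals. -/
def zariskiClosure (K : Type*) {V : Type*} [Field K] [AddCommGroup V] [Module K V]
    (S : Set V) : Set V :=
  {v | ∀ P : MvPolynomial (Module.Dual K V) K,
    (∀ s ∈ S, MvPolynomial.eval (fun l : Module.Dual K V => l s) P = 0) →
      MvPolynomial.eval (fun l : Module.Dual K V => l v) P = 0}

/-- The orbit of a triple under a subgroup of `SL₃` acting by conjugation. -/
def slOrbit {K : Type*} [Field K] (N : Subgroup SL(3, K)) (F : Triple K) : Set (Triple K) :=
  {F' | ∃ A ∈ N, Matrix.SpecialLinearGroup.toGL A • F = F'}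

/-- GIT semistability of a point for a (reductive) subgroup of `SL₃`: the closure of the orbit of a
lift to the affine cone does not contain the origin. -/
def IsSemistable {K : Type*} [Field K] (N : Subgroup SL(3, K)) (f : Rat22 K) : Prop :=
  (0 : Triple K) ∉ zariskiClosure K (slOrbit N f.rep)

/-- GIT stability (proper stability) of a point for a (reductive) subgroup of `SL₃`: the orbit of a
lift to the affine cone is closed and the lift has finite stabilizer. -/
def IsStable {K : Type*} [Field K] (N : Subgroup SL(3, K)) (f : Rat22 K) : Prop :=
  zariskiClosure K (slOrbit N f.rep) = slOrbit N f.rep ∧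
    {A : SL(3, K) | A ∈ N ∧ Matrix.SpecialLinearGroup.toGL A • f.rep = f.rep}.Finite

/-- The matrix `diag(1, i, -1)`, for a primitive fourth root of unity `i`. -/
def tau {K : Type*} [Field K] (i : K) (hi : IsPrimitiveRoot i 4) : GL (Fin 3) K :=
  Matrix.GeneralLinearGroup.mkOfDetNeZero (Matrix.diagonal ![1, i, -1]) (by
    simp [Matrix.det_diagonal, Fin.prod_univ_three, hi.ne_zero (by norm_num)])

/-- The cyclic subgroup of `PGL₃` generated by the class of `diag(1, i, -1)`. -/
def G4 {K : Type*} [Field K] (i : K) (hi : IsPrimitiveRoot i 4) : Subgroup (PGL(3, K)) :=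
  Subgroup.zpowers (Matrix.ProjGenLinGroup.mk (tau i hi))

theorem sq_eq_neg_one {K : Type*} [Field K] {i : K} (hi : IsPrimitiveRoot i 4) :
    i ^ 2 = -1 := by
  have h4 := hi.pow_eq_one
  have h2 : i ^ 2 ≠ 1 := hi.pow_ne_one_of_pos_of_lt (by norm_num) (by norm_num)
  have h : (i ^ 2 - 1) * (i ^ 2 + 1) = 0 := by linear_combination h4
  rcases mul_eq_zero.1 h with h | h
  · exact absurd (sub_eq_zero.1 h) h2
  · exact eq_neg_of_add_eq_zero_left h

/-- The matrix `-i · diag(1, i, -1) = diag(-i, 1, i)` of determinant 1. -/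
def tauSL {K : Type*} [Field K] (i : K) (hi : IsPrimitiveRoot i 4) : SL(3, K) :=
  ⟨Matrix.diagonal ![-i, 1, i], by
    have := sq_eq_neg_one hi
    simp [Matrix.det_diagonal, Fin.prod_univ_three]
    linear_combination -this⟩

/-- The lift of `G4` to an isomorphic subgroup of `SL₃`. -/
def G4Lift {K : Type*} [Field K] (i : K) (hi : IsPrimitiveRoot i 4) : Subgroup SL(3, K) :=
  Subgroup.zpowers (tauSL i hi)

/-- `G4Lift` is mapped bijectively onto `G4` by the projection from `SL₃` to `PGL₃`. -/
theorem bijOn_G4Lift {K : Type*} [Field K] (i : K) (hi : IsPrimitiveRoot i 4) :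
    Set.BijOn (Matrix.SpecialLinearGroup.toPGL : SL(3, K) →* PGL(3, K))
      (G4Lift i hi : Set SL(3, K)) (G4 i hi : Set (PGL(3, K))) := by
  have hsq := sq_eq_neg_one hi
  have hmap : Matrix.SpecialLinearGroup.toPGL (tauSL i hi) =
      Matrix.ProjGenLinGroup.mk (tau i hi) := by
    have h0 : -i ≠ 0 := neg_ne_zero.2 (hi.ne_zero (by norm_num))
    symm
    refine Matrix.ProjGenLinGroup.mk_eq_mk_iff.2 ⟨Units.mk0 (-i) h0, ?_⟩
    refine Units.ext ?_
    change Matrix.diagonal ![1, i, -1] * Matrix.scalar (Fin 3) (-i) = Matrix.diagonal ![-i, 1, i]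
    rw [Matrix.scalar_apply, Matrix.diagonal_mul_diagonal]
    congr 1
    funext a
    fin_cases a
    · simp
    · change i * -i = 1
      linear_combination -hsq
    · simp
  refine ⟨?_, ?_, ?_⟩
  · rintro _ ⟨k, rfl⟩
    exact ⟨k, by simp only [map_zpow, hmap]⟩
  · have hpow : ∀ m : ℕ, ((tauSL i hi ^ m : SL(3, K)) : Matrix (Fin 3) (Fin 3) K) =
        Matrix.diagonal (![-i, 1, i] ^ m) := by
      intro m
      rw [Matrix.SpecialLinearGroup.coe_pow]
      exact Matrix.diagonal_pow _ m
    have h4 : tauSL i hi ^ 4 = 1 := by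
      refine Subtype.ext ?_
      change ((tauSL i hi ^ 4 : SL(3, K)) : Matrix (Fin 3) (Fin 3) K) = 1
      rw [hpow, ← Matrix.diagonal_one]
      congr 1
      have hq : i ^ 4 = 1 := hi.pow_eq_one
      funext a
      fin_cases a
      · change (-i) ^ 4 = 1
        linear_combination hq
      · simp
      · simp [hq]
    have hker : ∀ n : ℤ, Matrix.SpecialLinearGroup.toPGL (tauSL i hi ^ n) = 1 →
        tauSL i hi ^ n = 1 := by
      intro n hn
      rw [← MonoidHom.mem_ker, Matrix.SpecialLinearGroup.toPGL_ker,
        Matrix.SpecialLinearGroup.mem_center_iff] at hn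
      obtain ⟨r, -, hr⟩ := hn
      obtain ⟨m, hm⟩ : ∃ m : ℕ, tauSL i hi ^ n = tauSL i hi ^ m := by
        refine ⟨(n % 4).toNat, ?_⟩
        rw [← zpow_natCast, Int.toNat_of_nonneg (Int.emod_nonneg _ (by norm_num))]
        conv_lhs => rw [← Int.emod_add_mul_ediv n 4]
        rw [zpow_add, zpow_mul, show (4 : ℤ) = ((4 : ℕ) : ℤ) from rfl, zpow_natCast, h4,
          one_zpow, mul_one]
      rw [hm] at hr ⊢
      rw [hpow] at hr
      have h1 : r = 1 := by
        have := congrFun (congrFun hr 1) 1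
        simpa [Matrix.scalar_apply] using this
      refine Subtype.ext ?_
      change ((tauSL i hi ^ m : SL(3, K)) : Matrix (Fin 3) (Fin 3) K) = 1
      rw [hpow, ← hr, h1, map_one]
    rintro _ ⟨k, rfl⟩ _ ⟨l, rfl⟩ h
    have := hker (k - l) (by
      rw [zpow_sub, map_mul, map_inv]
      exact mul_inv_eq_one.2 h)
    rw [zpow_sub] at this
    exact mul_inv_eq_one.1 this
  · rintro _ ⟨k, rfl⟩
    exact ⟨tauSL i hi ^ k, ⟨k, rfl⟩, by simp only [map_zpow, hmap]⟩

/-- `N(G4)`-stability of a map, where the normalizer is that of the lift of `G4` in `SL₃`. -/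
def IsNormalizerStable {K : Type*} [Field K] (i : K) (hi : IsPrimitiveRoot i 4)
    (f : Rat22 K) : Prop :=
  IsStable (Subgroup.normalizer (G4Lift i hi : Set SL(3, K))) f

/-- The set of `N(G4)`-semistable maps whose automorphism group contains `G4`. -/
def Rat22G4ss {K : Type*} [Field K] (i : K) (hi : IsPrimitiveRoot i 4) : Set (Rat22 K) :=
  {f | G4 i hi ≤ Aut f ∧ IsSemistable (Subgroup.normalizer (G4Lift i hi : Set SL(3, K))) f}

/-- Two maps are `N(G4)`-conjugate. -/
def NormalizerConj {K : Type*} [Field K] (i : K) (hi : IsPrimitiveRoot i 4)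
    (f f' : Rat22 K) : Prop :=
  ∃ φ ∈ Subgroup.normalizer (G4 i hi : Set (PGL(3, K))), conj f φ = f'

open MvPolynomial in
/-- The forms `aX² + Z², XY, Y² + eXZ`. -/
def aeTriple {K : Type*} [Field K] (a e : K) : Triple K :=
  Triple.of ![C a * X 0 ^ 2 + X 2 ^ 2, X 0 * X 1, X 1 ^ 2 + C e * X 0 * X 2] (by
    have hX := isHomogeneous_X K (σ := Fin 3)
    have hC := isHomogeneous_C (R := K) (Fin 3)
    intro i
    fin_cases i
    · exact ((hC a).mul ((hX 0).pow 2)).add ((hX 2).pow 2)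
    · exact (hX 0).mul (hX 1)
    · exact ((hX 1).pow 2).add (((hC e).mul (hX 0)).mul (hX 2)))

theorem aeTriple_ne_zero {K : Type*} [Field K] (a e : K) : aeTriple a e ≠ 0 := by
  intro h
  have h1 : (aeTriple a e).coord 1 = (0 : Triple K).coord 1 := by rw [h]
  have h2 := congrArg (MvPolynomial.eval (fun _ : Fin 3 => (1 : K))) h1
  simp [aeTriple, Triple.coord_of, Triple.coord_zero] at h2

/-- The map `f_{a,e} = [aX² + Z², XY, Y² + eXZ]`. -/
def fae {K : Type*} [Field K] (a e : K) : Rat22 K :=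
  Projectivization.mk K (aeTriple a e) (aeTriple_ne_zero a e)

open MvPolynomial in
/-- The forms `YZ, X² + cZ², XY`. -/
def cTriple {K : Type*} [Field K] (c : K) : Triple K :=
  Triple.of ![X 1 * X 2, X 0 ^ 2 + C c * X 2 ^ 2, X 0 * X 1] (by
    have hX := isHomogeneous_X K (σ := Fin 3)
    have hC := isHomogeneous_C (R := K) (Fin 3)
    intro i
    fin_cases i
    · exact (hX 1).mul (hX 2)
    · exact ((hX 0).pow 2).add ((hC c).mul ((hX 2).pow 2))
    · exact (hX 0).mul (hX 1))

theorem cTriple_ne_zero {K : Type*} [Field K] (c : K) : cTriple c ≠ 0 := by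
  intro h
  have h1 : (cTriple c).coord 0 = (0 : Triple K).coord 0 := by rw [h]
  have h2 := congrArg (MvPolynomial.eval (fun _ : Fin 3 => (1 : K))) h1
  simp [cTriple, Triple.coord_of, Triple.coord_zero] at h2

/-- The map `f_c = [YZ, X² + cZ², XY]`. -/
def fc {K : Type*} [Field K] (c : K) : Rat22 K :=
  Projectivization.mk K (cTriple c) (cTriple_ne_zero c)

end QuadraticMaps

end

/-!
Everything is reduced to comparing coefficients. A triple of quadratic forms is given by the
`3 × 6` array of its coefficients (`ofCoeffs`, `exists_ofCoeffs`), and `g • F = F'` means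
`g (F v) = F' (g v)` for all `v` (`smul_eq_iff`). A scalar matrix `u` multiplies triples by `u⁻¹`,
so every class in `PGL₃` that conjugates one map into another has a lift that does so on the nose
(`conj_mk_eq_iff`), unique when the two triples agree (`eq_of_mk_eq_of_smul_eq`).

The normalizers of the group of order four, in `PGL₃` and in `SL₃`, consist of diagonal and
antidiagonal matrices (`diagonal_or_antidiagonal_of_mk_mem_normalizer`): a determinant that does
not vanish has a nonvanishing Leibniz term, and of the six permutations only the identity and the
exchange of `X` and `Z` are compatible with the eigenvalues `1, i, -1`.

If the class of `F` is fixed by the group, then `F` is an eigenvector of `diag(1, i, -1)`, which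
leaves four shapes (`shape_of_G4_le_aut`). One of them commutes with a one-dimensional torus and
has infinite automorphism group; two of them are exchanged with each other by `X ↔ Z`. For the
remaining `(aX² + bZ², cXY, dY² + eXZ)` and `(aYZ, bX² + cZ², dXY)`, semistability and dominance
say that enough coefficients do not vanish: were `b` or `d` zero in the former, a torus element
would rescale the triple by any given factor. The nonvanishing coefficients are normalized to `1`
by a diagonal matrix. The torus orbit is closed because it is cut out by explicit monomial relations
(`zariskiClosure_torusOrbit_diagShape`, `zariskiClosure_torusOrbit_crossShape`), and the orbit of
the normalizer is the union of two translates of it. Stabilizers are finite since they embed into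
`Aut(f)`. The value `c = -1` is excluded by another one-dimensional group of automorphisms.

The groups `Aut(f_{a,e})` and, for `c ≠ ±1`, `Aut(f_c)` come from eliminating the unknown entries of
a matrix from the eighteen coefficient equations of `g • F = F` (`smul_aeTriple_eq_self`,
`smul_cTriple_eq_self`). Finally, `f₁` lifts to a self-map of affine 3-space with exactly four
nonzero fixed points `v₀, …, v₃`. They span the space and have sum zero, and for the dual forms `wⱼ`
with `wⱼ(vₖ) = δⱼₖ - 1/4` the map is `v ↦ 2 ∑ⱼ wⱼ(v)² vⱼ`. This expression is symmetric in the four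
points, so each permutation of them extends to an automorphism (`permHom_smul_cTriple`), and each
automorphism arises in this way (`exists_permHom_eq`).
-/

noncomputable section

namespace QuadraticMaps

/-! ### Triples of quadratic forms as self-maps of affine space -/

section Triples

variable {K : Type*} [Field K]

theorem Triple.eval_gl_smul (g : GL (Fin 3) K) (F : Triple K) (v : Fin 3 → K) :
    (g • F).eval v = Matrix.mulVec g.1 (F.eval (Matrix.mulVec (g⁻¹ : GL (Fin 3) K).1 v)) := by
  funext j
  have h : (fun k => MvPolynomial.eval v ((g⁻¹ : GL (Fin 3) K).1.toMvPolynomial k)) =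
      Matrix.mulVec (g⁻¹ : GL (Fin 3) K).1 v := by
    funext k
    exact Matrix.toMvPolynomial_eval_eq_apply _ _ _
  simp only [Triple.eval, Triple.coord_gl_smul, conjCoord, map_sum, Matrix.mulVec, dotProduct,
    MvPolynomial.smul_eval]
  refine Finset.sum_congr rfl fun l _ => ?_
  congr 1
  exact (MvPolynomial.eval₂Hom_bind₁ _ _ _ _).trans (congrArg (fun w => MvPolynomial.eval w _) h)

theorem Triple.ext_eval [Infinite K] {F F' : Triple K} (h : ∀ v, F.eval v = F'.eval v) :
    F = F' :=
  Triple.ext_coord fun j => MvPolynomial.funext fun v => congrFun (h v) j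

/-- `g • F = F'` means that `g` intertwines the self-maps `F` and `F'` of affine 3-space. -/
theorem smul_eq_iff [Infinite K] {g : GL (Fin 3) K} {F F' : Triple K} :
    g • F = F' ↔ ∀ v, Matrix.mulVec g.1 (F.eval v) = F'.eval (Matrix.mulVec g.1 v) := by
  constructor
  · rintro rfl v
    rw [Triple.eval_gl_smul, Matrix.mulVec_mulVec, ← Units.val_mul, inv_mul_cancel, Units.val_one,
      Matrix.one_mulVec]
  · intro h
    refine Triple.ext_eval fun v => ?_
    rw [Triple.eval_gl_smul, h, Matrix.mulVec_mulVec, ← Units.val_mul, mul_inv_cancel,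
      Units.val_one, Matrix.one_mulVec]

/-- The quadratic monomials `X², Y², Z², XY, XZ, YZ`, in this order, as functions. -/
def monom (m : Fin 6) (v : Fin 3 → K) : K :=
  ![v 0 ^ 2, v 1 ^ 2, v 2 ^ 2, v 0 * v 1, v 0 * v 2, v 1 * v 2] m

open MvPolynomial in
/-- The quadratic monomials `X², Y², Z², XY, XZ, YZ`, in this order, as polynomials. -/
def monomPoly (K : Type*) [Field K] (m : Fin 6) : MvPolynomial (Fin 3) K :=
  ![X 0 ^ 2, X 1 ^ 2, X 2 ^ 2, X 0 * X 1, X 0 * X 2, X 1 * X 2] m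

theorem monomPoly_isHomogeneous (m : Fin 6) : (monomPoly K m).IsHomogeneous 2 := by
  have hX := MvPolynomial.isHomogeneous_X K (σ := Fin 3)
  fin_cases m
  · exact (hX 0).pow 2
  · exact (hX 1).pow 2
  · exact (hX 2).pow 2
  · exact (hX 0).mul (hX 1)
  · exact (hX 0).mul (hX 2)
  · exact (hX 1).mul (hX 2)

theorem eval_monomPoly (m : Fin 6) (v : Fin 3 → K) :
    MvPolynomial.eval v (monomPoly K m) = monom m v := by
  fin_cases m <;> simp [monomPoly, monom]

/-- The triple whose `j`-th form has the coefficients `A j` at `X², Y², Z², XY, XZ, YZ`. -/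
def ofCoeffs (A : Fin 3 → Fin 6 → K) : Triple K :=
  Triple.of (fun j => ∑ m, A j m • monomPoly K m) fun _ =>
    MvPolynomial.IsHomogeneous.sum _ _ _ fun m _ =>
      (MvPolynomial.mem_homogeneousSubmodule 2 _).1 <| Submodule.smul_mem _ _ <|
        (MvPolynomial.mem_homogeneousSubmodule 2 _).2 <| monomPoly_isHomogeneous m

theorem eval_ofCoeffs (A : Fin 3 → Fin 6 → K) (v : Fin 3 → K) (j : Fin 3) :
    (ofCoeffs A).eval v j = ∑ m, A j m * monom m v := by
  simp [ofCoeffs, Triple.eval, Triple.coord_of, map_sum, eval_monomPoly]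

theorem eval_ofCoeffs_apply (A : Fin 3 → Fin 6 → K) (v : Fin 3 → K) (j : Fin 3) :
    (ofCoeffs A).eval v j = A j 0 * v 0 ^ 2 + A j 1 * v 1 ^ 2 + A j 2 * v 2 ^ 2 +
      A j 3 * (v 0 * v 1) + A j 4 * (v 0 * v 2) + A j 5 * (v 1 * v 2) := by
  rw [eval_ofCoeffs, Fin.sum_univ_six]
  rfl

/-- Every ternary quadratic form is a combination of the six quadratic monomials. -/
theorem exists_sum_monom {p : MvPolynomial (Fin 3) K} (hp : p.IsHomogeneous 2) :
    ∃ c : Fin 6 → K, ∀ v, MvPolynomial.eval v p = ∑ m, c m * monom m v := by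
  have hmon : ∀ d : Fin 3 →₀ ℕ, d.degree = 2 → ∀ r : K,
      ∃ c : Fin 6 → K, ∀ v, MvPolynomial.eval v (MvPolynomial.monomial d r) =
        ∑ m, c m * monom m v := by
    intro d hd r
    have hsum : d 0 + d 1 + d 2 = 2 := by
      rw [Finsupp.degree_eq_sum, Fin.sum_univ_three] at hd
      exact hd
    have hev : ∀ v : Fin 3 → K, MvPolynomial.eval v (MvPolynomial.monomial d r) =
        r * (v 0 ^ d 0 * v 1 ^ d 1 * v 2 ^ d 2) := by
      intro v
      rw [MvPolynomial.eval_monomial, Finsupp.prod_fintype _ _ (by simp), Fin.prod_univ_three]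
    have hcase : ∃ m : Fin 6, ∀ v : Fin 3 → K,
        v 0 ^ d 0 * v 1 ^ d 1 * v 2 ^ d 2 = monom m v := by
      have h0 : d 0 ≤ 2 := by omega
      have h1 : d 1 ≤ 2 := by omega
      interval_cases h : d 0 <;> interval_cases h' : d 1
      · exact ⟨2, fun v => by rw [show d 2 = 2 by omega]; simp [monom]⟩
      · exact ⟨5, fun v => by rw [show d 2 = 1 by omega]; simp [monom]⟩
      · exact ⟨1, fun v => by rw [show d 2 = 0 by omega]; simp [monom]⟩
      · exact ⟨4, fun v => by rw [show d 2 = 1 by omega]; simp [monom]⟩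
      · exact ⟨3, fun v => by rw [show d 2 = 0 by omega]; simp [monom]⟩
      · omega
      · exact ⟨0, fun v => by rw [show d 2 = 0 by omega]; simp [monom]⟩
      · omega
      · omega
    obtain ⟨m, hm⟩ := hcase
    refine ⟨Pi.single m r, fun v => ?_⟩
    rw [hev, hm, Finset.sum_eq_single m]
    · simp
    · intro b _ hb
      simp [hb]
    · simp
  choose! c hc using hmon
  refine ⟨fun m => ∑ d ∈ p.support, c d (p.coeff d) m, fun v => ?_⟩
  conv_lhs => rw [p.as_sum, map_sum]
  simp only [Finset.sum_mul]
  rw [Finset.sum_comm]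
  refine Finset.sum_congr rfl fun d hd => hc d ?_ _ v
  rw [Finsupp.degree_eq_weight_one]
  exact hp (MvPolynomial.mem_support_iff.1 hd)

theorem exists_ofCoeffs [Infinite K] (F : Triple K) : ∃ A, F = ofCoeffs A := by
  choose A hA using fun j => exists_sum_monom (F.coord_isHomogeneous j)
  refine ⟨A, Triple.ext_eval fun v => funext fun j => ?_⟩
  rw [eval_ofCoeffs]
  exact hA j v

/-- The value of the `j`-th form at `v`, as a linear functional of the triple. -/
def evalDual (v : Fin 3 → K) (j : Fin 3) : Module.Dual K (Triple K) where
  toFun F := F.eval v j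
  map_add' F F' := by simp [Triple.eval, Triple.coord_add]
  map_smul' c F := by simp [Triple.eval, Triple.coord_smul]

/-- The coefficients of the `j`-th form, as linear functionals of the triple; the mixed coefficients
are recovered from values by polarization. -/
def coeffDual (j : Fin 3) (m : Fin 6) : Module.Dual K (Triple K) :=
  ![evalDual ![1, 0, 0] j, evalDual ![0, 1, 0] j, evalDual ![0, 0, 1] j,
    evalDual ![1, 1, 0] j - evalDual ![1, 0, 0] j - evalDual ![0, 1, 0] j,
    evalDual ![1, 0, 1] j - evalDual ![1, 0, 0] j - evalDual ![0, 0, 1] j,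
    evalDual ![0, 1, 1] j - evalDual ![0, 1, 0] j - evalDual ![0, 0, 1] j] m

@[simp]
theorem coeffDual_ofCoeffs (A : Fin 3 → Fin 6 → K) (j : Fin 3) (m : Fin 6) :
    coeffDual j m (ofCoeffs A) = A j m := by
  have h : ∀ v, evalDual v j (ofCoeffs A) = (ofCoeffs A).eval v j := fun _ => rfl
  fin_cases m <;> simp [coeffDual, h, eval_ofCoeffs_apply]
  all_goals ring

theorem ofCoeffs_coeffDual [Infinite K] (F : Triple K) :
    ofCoeffs (fun j m => coeffDual j m F) = F := by
  obtain ⟨A, rfl⟩ := exists_ofCoeffs F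
  simp

theorem ofCoeffs_injective : Function.Injective (ofCoeffs : (Fin 3 → Fin 6 → K) → Triple K) := by
  intro A B h
  funext j m
  rw [← coeffDual_ofCoeffs A, h, coeffDual_ofCoeffs]

theorem smul_ofCoeffs (c : K) (A : Fin 3 → Fin 6 → K) : c • ofCoeffs A = ofCoeffs (c • A) := by
  refine Triple.ext_coord fun j => ?_
  simp [ofCoeffs, Triple.coord_smul, Triple.coord_of, Finset.smul_sum, smul_smul]

theorem ofCoeffs_zero : ofCoeffs (0 : Fin 3 → Fin 6 → K) = 0 := by
  refine Triple.ext_coord fun j => ?_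
  simp [ofCoeffs, Triple.coord_zero, Triple.coord_of]

theorem monom_mul (m : Fin 6) (p v : Fin 3 → K) : monom m (p * v) = monom m p * monom m v := by
  fin_cases m <;> simp [monom] <;> ring

theorem exists_gl_diagonal {p q r : K} (hp : p ≠ 0) (hq : q ≠ 0) (hr : r ≠ 0) :
    ∃ g : GL (Fin 3) K, g.1 = Matrix.diagonal ![p, q, r] :=
  ⟨Matrix.GeneralLinearGroup.mkOfDetNeZero (Matrix.diagonal ![p, q, r])
    (by simp [Matrix.det_diagonal, Fin.prod_univ_three, hp, hq, hr]), rfl⟩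

/-- A diagonal matrix multiplies each coefficient by a character of the torus; the equations are
stated without denominators. -/
theorem diagonal_smul_ofCoeffs_iff [Infinite K] {g : GL (Fin 3) K} {p : Fin 3 → K}
    (hg : g.1 = Matrix.diagonal p) (A B : Fin 3 → Fin 6 → K) :
    g • ofCoeffs A = ofCoeffs B ↔ ∀ j m, p j * A j m = B j m * monom m p := by
  have h1 : ∀ v, Matrix.mulVec g.1 v = p * v := by
    intro v
    funext j
    rw [hg, Matrix.mulVec_diagonal]
    rfl
  rw [smul_eq_iff]
  have h2 : ∀ v, Matrix.mulVec g.1 ((ofCoeffs A).eval v) =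
      (ofCoeffs fun j m => p j * A j m).eval v := by
    intro v
    funext j
    rw [h1, Pi.mul_apply, eval_ofCoeffs, eval_ofCoeffs, Finset.mul_sum]
    simp only [mul_assoc]
  have h3 : ∀ v, (ofCoeffs B).eval (Matrix.mulVec g.1 v) =
      (ofCoeffs fun j m => B j m * monom m p).eval v := by
    intro v
    funext j
    rw [h1, eval_ofCoeffs, eval_ofCoeffs]
    simp only [mul_assoc, monom_mul]
  simp only [h2, h3]
  constructor
  · intro h j m
    exact congrFun (congrFun (ofCoeffs_injective (Triple.ext_eval h)) j) m
  · intro h v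
    rw [funext fun j => funext (h j)]

end Triples

/-! ### Lifting conjugations from `PGL₃` to `GL₃` -/

section Projective

variable {K : Type*} [Field K]

/-- The scalar in an equality of points of projective space can be absorbed into the matrix. -/
theorem conj_mk_eq_iff {F F' : Triple K} (hF : F ≠ 0) (hF' : F' ≠ 0) (φ : PGL(3, K)) :
    conj (Projectivization.mk K F hF) φ = Projectivization.mk K F' hF' ↔
      ∃ g : GL (Fin 3) K, Matrix.ProjGenLinGroup.mk g = φ ∧ g • F' = F := by
  rw [conj, inv_smul_eq_iff]
  constructor
  · induction φ using Matrix.ProjGenLinGroup.induction_on with | mk g =>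
    intro h
    have h' : Projectivization.mk K F hF = g • Projectivization.mk K F' hF' := h
    rw [Projectivization.smul_mk, Projectivization.mk_eq_mk_iff] at h'
    obtain ⟨u, hu⟩ := h'
    refine ⟨g * Matrix.GeneralLinearGroup.scalar (Fin 3) u⁻¹,
      by rw [map_mul, Matrix.ProjGenLinGroup.mk_scalar, mul_one], ?_⟩
    rw [mul_smul, scalar_smul_triple, inv_inv, ← hu]
    exact smul_comm g (u : K) F'
  · rintro ⟨g, rfl, rfl⟩
    change _ = g • Projectivization.mk K F' hF'
    rw [Projectivization.smul_mk]

theorem mem_aut_mk_iff {F : Triple K} (hF : F ≠ 0) (φ : PGL(3, K)) :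
    φ ∈ Aut (Projectivization.mk K F hF) ↔
      ∃ g : GL (Fin 3) K, Matrix.ProjGenLinGroup.mk g = φ ∧ g • F = F :=
  conj_mk_eq_iff hF hF φ

/-- A nonzero triple is fixed by no scalar matrix but the identity, so a matrix fixing it is
determined by its class. -/
theorem eq_of_mk_eq_of_smul_eq {F : Triple K} (hF : F ≠ 0) {g h : GL (Fin 3) K}
    (hgh : Matrix.ProjGenLinGroup.mk g = Matrix.ProjGenLinGroup.mk h) (hg : g • F = F)
    (hh : h • F = F) : g = h := by
  obtain ⟨u, rfl⟩ := Matrix.ProjGenLinGroup.mk_eq_mk_iff.1 hgh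
  rw [mul_smul, scalar_smul_triple, Units.smul_def, smul_comm, hg] at hh
  have h1 : ((u⁻¹ : Kˣ) : K) = 1 := by
    have : (((u⁻¹ : Kˣ) : K) - 1) • F = 0 := by rw [sub_smul, hh, one_smul, sub_self]
    exact sub_eq_zero.1 ((smul_eq_zero.1 this).resolve_right hF)
  have h2 : u = 1 := by
    rw [← inv_eq_one]
    exact Units.ext h1
  rw [h2, map_one, mul_one]

/-- Changing coordinates conjugates the automorphism group. -/
theorem finite_aut_of_smul_eq {F F' : Triple K} (hF : F ≠ 0) (hF' : F' ≠ 0) {g : GL (Fin 3) K}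
    (hg : g • F' = F) (h : Finite (Aut (Projectivization.mk K F hF))) :
    Finite (Aut (Projectivization.mk K F' hF')) := by
  refine Finite.of_injective (β := Aut (Projectivization.mk K F hF))
    (fun φ => ⟨Matrix.ProjGenLinGroup.mk g * φ.1 * (Matrix.ProjGenLinGroup.mk g)⁻¹, ?_⟩) ?_
  · obtain ⟨h, hh, hF⟩ := (mem_aut_mk_iff hF' _).1 φ.2
    refine (mem_aut_mk_iff _ _).2 ⟨g * h * g⁻¹, by simp [hh], ?_⟩
    rw [mul_smul, mul_smul, ← hg, inv_smul_smul, hF]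
  · intro φ ψ h
    have := congrArg Subtype.val h
    exact Subtype.ext (by simpa using this)

/-- A dominant map has no vanishing coordinate. -/
theorem IsDominant.exists_eval_ne_zero {f : Rat22 K} (h : IsDominant f) (j : Fin 3) :
    ∃ v, f.rep.eval v j ≠ 0 := by
  by_contra! hc
  refine MvPolynomial.X_ne_zero (R := K) j (h 1 _ (MvPolynomial.isHomogeneous_X K j) fun v _ => ?_)
  simpa using hc v

end Projective

/-! ### The Zariski closure -/

section Zariski

variable {K V : Type*} [Field K] [AddCommGroup V] [Module K V]

theorem subset_zariskiClosure (S : Set V) : S ⊆ zariskiClosure K S := fun s hs _ hP => hP s hs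

/-- A polynomial relation between finitely many linear functionals extends to the closure. -/
theorem eval_eq_zero_of_mem_zariskiClosure {ι : Type*} (l : ι → Module.Dual K V)
    (P : MvPolynomial ι K) {S : Set V} (hP : ∀ s ∈ S, MvPolynomial.eval (fun k => l k s) P = 0)
    {v : V} (hv : v ∈ zariskiClosure K S) : MvPolynomial.eval (fun k => l k v) P = 0 := by
  have := hv (MvPolynomial.rename l P) fun s hs => by
    rw [MvPolynomial.eval_rename]
    exact hP s hs
  rwa [MvPolynomial.eval_rename] at this

theorem dual_eq_zero_of_mem_zariskiClosure (l : Module.Dual K V) {S : Set V}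
    (hS : ∀ s ∈ S, l s = 0) {v : V} (hv : v ∈ zariskiClosure K S) : l v = 0 := by
  have := eval_eq_zero_of_mem_zariskiClosure (fun _ : Unit => l) (MvPolynomial.X ())
    (fun s hs => by simpa using hS s hs) hv
  simpa using this

theorem zariskiClosure_union_subset (S T : Set V) :
    zariskiClosure K (S ∪ T) ⊆ zariskiClosure K S ∪ zariskiClosure K T := by
  intro v hv
  by_contra hc
  simp only [Set.mem_union, not_or, zariskiClosure, Set.mem_ofPred_eq, not_forall] at hc
  obtain ⟨⟨P, hP, hPv⟩, Q, hQ, hQv⟩ := hc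
  have := hv (P * Q) (by
    rintro s (hs | hs)
    · rw [map_mul, hP s hs, zero_mul]
    · rw [map_mul, hQ s hs, mul_zero])
  rw [map_mul] at this
  exact (mul_ne_zero hPv hQv) this

/-- Linear maps are continuous for the Zariski topology. -/
theorem map_mem_zariskiClosure (f : V →ₗ[K] V) {S T : Set V} (h : ∀ s ∈ S, f s ∈ T) {v : V}
    (hv : v ∈ zariskiClosure K S) : f v ∈ zariskiClosure K T := fun P hP =>
  eval_eq_zero_of_mem_zariskiClosure (fun l : Module.Dual K V => l ∘ₗ f) P
    (fun s hs => hP (f s) (h s hs)) hv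

/-- The closure of a set containing a punctured line through the origin contains the origin. -/
theorem zero_mem_zariskiClosure [Infinite K] {S : Set V} {F : V}
    (h : ∀ t : K, t ≠ 0 → t • F ∈ S) : (0 : V) ∈ zariskiClosure K S := by
  intro P hP
  let Q : Polynomial K :=
    MvPolynomial.aeval (fun l : Module.Dual K V => Polynomial.X * Polynomial.C (l F)) P
  have hQ : ∀ t : K, Q.eval t = MvPolynomial.eval (fun l : Module.Dual K V => l (t • F)) P := by
    intro t
    have : Q.eval t = (Polynomial.aeval t) Q := by simp [Polynomial.aeval_def]
    rw [this, ← MvPolynomial.aeval_eq_eval, MvPolynomial.aeval_def]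
    simp only [Q]
    rw [← AlgHom.comp_apply, MvPolynomial.comp_aeval]
    simp only [map_mul, Polynomial.aeval_X, Polynomial.aeval_C, map_smul, smul_eq_mul]
    rfl
  have h0 : Polynomial.X * Q = 0 := Polynomial.funext fun t => by
    by_cases ht : t = 0
    · simp [ht]
    · rw [Polynomial.eval_mul, hQ, hP _ (h t ht), mul_zero, Polynomial.eval_zero]
  have hQ0 : Q = 0 := (mul_eq_zero.1 h0).resolve_left Polynomial.X_ne_zero
  have := hQ 0
  rw [hQ0, Polynomial.eval_zero, zero_smul] at this
  exact this.symm

end Zariski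

/-! ### Diagonal and antidiagonal matrices and the normalizer in `PGL₃` -/

section Normalizer

variable {K : Type*} [Field K]

/-- The matrix with the given entries, row by row, on the antidiagonal. -/
def antidiagonal (p : Fin 3 → K) : Matrix (Fin 3) (Fin 3) K := !![0, 0, p 0; 0, p 1, 0; p 2, 0, 0]

theorem antidiagonal_mulVec (p v : Fin 3 → K) (j : Fin 3) :
    Matrix.mulVec (antidiagonal p) v j = p j * v (Fin.rev j) := by
  fin_cases j <;> simp [antidiagonal, Matrix.mulVec, dotProduct, Fin.sum_univ_three]

theorem det_antidiagonal (p : Fin 3 → K) : (antidiagonal p).det = -(p 0 * p 1 * p 2) := by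
  rw [Matrix.det_fin_three]
  simp [antidiagonal]

theorem exists_gl_antidiagonal {p q r : K} (hp : p ≠ 0) (hq : q ≠ 0) (hr : r ≠ 0) :
    ∃ g : GL (Fin 3) K, g.1 = antidiagonal ![p, q, r] :=
  ⟨Matrix.GeneralLinearGroup.mkOfDetNeZero (antidiagonal ![p, q, r])
    (by simp [det_antidiagonal, hp, hq, hr]), rfl⟩

/-- The effect of exchanging `X` and `Z` on the monomials `X², Y², Z², XY, XZ, YZ`. -/
def revMonom : Fin 6 → Fin 6 := ![2, 1, 0, 5, 4, 3]

theorem monom_antidiagonal (m : Fin 6) (p v : Fin 3 → K) :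
    monom m (Matrix.mulVec (antidiagonal p) v) = monom m p * monom (revMonom m) v := by
  have h : Matrix.mulVec (antidiagonal p) v = p * fun j => v (Fin.rev j) := by
    funext j
    exact antidiagonal_mulVec p v j
  rw [h, monom_mul]
  congr 1
  fin_cases m <;> simp [monom, revMonom, Fin.rev] <;> exact mul_comm _ _

theorem antidiagonal_smul_ofCoeffs_iff [Infinite K] {g : GL (Fin 3) K} {p : Fin 3 → K}
    (hg : g.1 = antidiagonal p) (A B : Fin 3 → Fin 6 → K) :
    g • ofCoeffs A = ofCoeffs B ↔
      ∀ j m, p j * A (Fin.rev j) (revMonom m) = B j m * monom m p := by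
  rw [smul_eq_iff]
  have hinv : ∀ m, revMonom (revMonom m) = m := by decide
  have hsum : ∀ f : Fin 6 → K, ∑ m, f (revMonom m) = ∑ m, f m := fun f =>
    Equiv.sum_comp (Function.Involutive.toPerm revMonom hinv) f
  have h2 : ∀ v, Matrix.mulVec g.1 ((ofCoeffs A).eval v) =
      (ofCoeffs fun j m => p j * A (Fin.rev j) m).eval v := by
    intro v
    funext j
    rw [hg, antidiagonal_mulVec, eval_ofCoeffs, eval_ofCoeffs, Finset.mul_sum]
    simp only [mul_assoc]
  have h3 : ∀ v, (ofCoeffs B).eval (Matrix.mulVec g.1 v) =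
      (ofCoeffs fun j m => B j (revMonom m) * monom (revMonom m) p).eval v := by
    intro v
    funext j
    rw [hg, eval_ofCoeffs, eval_ofCoeffs, ← hsum]
    simp only [monom_antidiagonal, hinv, mul_assoc]
  simp only [h2, h3]
  constructor
  · intro h j m
    have := congrFun (congrFun (ofCoeffs_injective (Triple.ext_eval h)) j) (revMonom m)
    simpa only [hinv] using this
  · intro h v
    congr 2
    funext j m
    have := h j (revMonom m)
    rwa [hinv] at this

/-- The cocharacter `w ↦ diag(1, w, w²)`; its value at `i` is `tau`. -/
def cochar (K : Type*) [Field K] : Kˣ →* GL (Fin 3) K where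
  toFun w := ⟨Matrix.diagonal ![1, (w : K), (w : K) ^ 2],
    Matrix.diagonal ![1, ((w⁻¹ : Kˣ) : K), ((w⁻¹ : Kˣ) : K) ^ 2],
    by
      rw [Matrix.diagonal_mul_diagonal, ← Matrix.diagonal_one]
      congr 1
      funext j
      fin_cases j <;> simp,
    by
      rw [Matrix.diagonal_mul_diagonal, ← Matrix.diagonal_one]
      congr 1
      funext j
      fin_cases j <;> simp⟩
  map_one' := by
    refine Units.ext ?_
    change Matrix.diagonal _ = 1
    rw [← Matrix.diagonal_one]
    congr 1
    funext j
    fin_cases j <;> simp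
  map_mul' a b := by
    refine Units.ext ?_
    change Matrix.diagonal _ = Matrix.diagonal _ * Matrix.diagonal _
    rw [Matrix.diagonal_mul_diagonal]
    congr 1
    funext j
    fin_cases j <;> simp [mul_pow]

theorem cochar_coe (w : Kˣ) :
    (cochar K w).1 = Matrix.diagonal ![1, (w : K), (w : K) ^ 2] := rfl

variable {i : K} (hi : IsPrimitiveRoot i 4)

theorem tau_coe : (tau i hi).1 = Matrix.diagonal ![1, i, -1] := rfl

theorem tau_eq_cochar : tau i hi = cochar K (Units.mk0 i (hi.ne_zero (by norm_num))) := by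
  refine Units.ext ?_
  rw [cochar_coe, tau_coe, Units.val_mk0, sq_eq_neg_one hi]

theorem mk_mem_G4_iff (g : GL (Fin 3) K) :
    Matrix.ProjGenLinGroup.mk g ∈ G4 i hi ↔
      ∃ u q : K, u ≠ 0 ∧ q ^ 4 = 1 ∧ g.1 = Matrix.diagonal ![u, u * q, u * q ^ 2] := by
  have hscal : ∀ (w u : Kˣ), (cochar K w * Matrix.GeneralLinearGroup.scalar (Fin 3) u).1 =
      Matrix.diagonal ![(u : K), u * w, u * (w : K) ^ 2] := by
    intro w u
    rw [Units.val_mul, cochar_coe, Matrix.GeneralLinearGroup.coe_scalar, Matrix.scalar_apply,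
      Matrix.diagonal_mul_diagonal]
    congr 1
    funext j
    fin_cases j <;> simp [mul_comm]
  constructor
  · rintro ⟨n, hn⟩
    change Matrix.ProjGenLinGroup.mk (tau i hi) ^ n = _ at hn
    rw [← map_zpow, Matrix.ProjGenLinGroup.mk_eq_mk_iff, tau_eq_cochar, ← map_zpow] at hn
    obtain ⟨u, rfl⟩ := hn
    refine ⟨u, _, u.ne_zero, ?_, hscal _ _⟩
    rw [← Units.val_pow_eq_pow_val, ← zpow_natCast, ← zpow_mul, mul_comm n, zpow_mul]
    have : Units.mk0 i (hi.ne_zero (by norm_num)) ^ ((4 : ℕ) : ℤ) = 1 := by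
      rw [zpow_natCast]
      exact Units.ext hi.pow_eq_one
    rw [this, one_zpow, Units.val_one]
  · rintro ⟨u, q, hu, hq, hg⟩
    obtain ⟨n, -, rfl⟩ := hi.eq_pow_of_pow_eq_one hq
    refine ⟨n, ?_⟩
    change Matrix.ProjGenLinGroup.mk (tau i hi) ^ (n : ℤ) = _
    rw [zpow_natCast, ← map_pow, tau_eq_cochar, ← map_pow, Matrix.ProjGenLinGroup.mk_eq_mk_iff]
    refine ⟨Units.mk0 u hu, Units.ext ?_⟩
    rw [hscal, hg]
    rfl

theorem ne_of_isPrimitiveRoot_four (hi : IsPrimitiveRoot i 4) :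
    i ≠ 0 ∧ i ≠ 1 ∧ i ≠ -1 ∧ (1 : K) ≠ -1 ∧ (2 : K) ≠ 0 := by
  have hsq := sq_eq_neg_one hi
  have h1 : i ≠ 1 := hi.ne_one (by norm_num)
  have h2 : (-1 : K) ≠ 1 := hsq ▸ hi.pow_ne_one_of_pos_of_lt (by norm_num) (by norm_num)
  refine ⟨hi.ne_zero (by norm_num), h1, ?_, h2.symm, ?_⟩
  · rintro rfl
    exact h2 (by linear_combination -hsq)
  · intro h
    exact h2 (by linear_combination -h)

theorem mem_normalizer_zpowers {G : Type*} [Group G] {g x : G}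
    (h : g * x * g⁻¹ = x ∨ g * x * g⁻¹ = x⁻¹) :
    g ∈ Subgroup.normalizer (Subgroup.zpowers x : Set G) := by
  rw [Subgroup.mem_normalizer_iff_map_conj_eq, MonoidHom.map_zpowers]
  change Subgroup.zpowers (g * x * g⁻¹) = _
  rcases h with h | h <;> rw [h]
  exact Subgroup.zpowers_inv

theorem mk_mem_normalizer_of_diagonal {g : GL (Fin 3) K} {p : Fin 3 → K}
    (hg : g.1 = Matrix.diagonal p) :
    Matrix.ProjGenLinGroup.mk g ∈ Subgroup.normalizer (G4 i hi : Set (PGL(3, K))) := by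
  refine mem_normalizer_zpowers (Or.inl ?_)
  rw [← map_mul, ← map_inv, ← map_mul, mul_inv_eq_iff_eq_mul.2]
  refine Units.ext ?_
  rw [Units.val_mul, Units.val_mul, hg, tau_coe, Matrix.diagonal_mul_diagonal,
    Matrix.diagonal_mul_diagonal]
  simp only [mul_comm]

theorem mk_mem_normalizer_of_antidiagonal {g : GL (Fin 3) K} {p : Fin 3 → K}
    (hg : g.1 = antidiagonal p) :
    Matrix.ProjGenLinGroup.mk g ∈ Subgroup.normalizer (G4 i hi : Set (PGL(3, K))) := by
  refine mem_normalizer_zpowers (Or.inr ?_)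
  rw [mul_inv_eq_iff_eq_mul, eq_inv_mul_iff_mul_eq, ← map_mul, ← map_mul]
  refine (Matrix.ProjGenLinGroup.mk_eq_mk_iff.2 ⟨-1, Units.ext ?_⟩).symm
  have hsq := sq_eq_neg_one hi
  rw [Units.val_mul, Units.val_mul, Units.val_mul, hg, tau_coe,
    Matrix.GeneralLinearGroup.coe_scalar, Matrix.scalar_apply]
  ext a b
  rw [Matrix.mul_diagonal, Matrix.diagonal_mul, Matrix.mul_diagonal]
  fin_cases a <;> fin_cases b <;> simp [antidiagonal]
  linear_combination -(p 1) * hsq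

/-- An element `g` of the normalizer satisfies `g · diag(1, i, -1) = u · diag(1, w, w²) · g` for
some `u` and `w`, so a nonzero entry in position `(a, b)` forces the `b`-th eigenvalue to be `u wᵃ`. -/
theorem diagonal_or_antidiagonal_of_mk_mem_normalizer {g : GL (Fin 3) K}
    (hg : Matrix.ProjGenLinGroup.mk g ∈ Subgroup.normalizer (G4 i hi : Set (PGL(3, K)))) :
    ∃ p q r : K, p ≠ 0 ∧ q ≠ 0 ∧ r ≠ 0 ∧
      (g.1 = Matrix.diagonal ![p, q, r] ∨ g.1 = antidiagonal ![p, q, r]) := by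
  obtain ⟨hi0, hi1, him, h11, h2⟩ := ne_of_isPrimitiveRoot_four hi
  have hsq := sq_eq_neg_one hi
  have h := (Subgroup.mem_normalizer_iff.1 hg _).1 (Subgroup.mem_zpowers _)
  rw [← map_mul, ← map_inv, ← map_mul] at h
  obtain ⟨u, w, hu, -, hw⟩ := (mk_mem_G4_iff hi _).1 h
  have hgt : g.1 * Matrix.diagonal ![1, i, -1] =
      Matrix.diagonal ![u, u * w, u * w ^ 2] * g.1 := by
    rw [← hw, ← tau_coe hi, ← Units.val_mul, ← Units.val_mul, inv_mul_cancel_right]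
  have hent : ∀ a b, g.1 a b * ![1, i, -1] b = ![u, u * w, u * w ^ 2] a * g.1 a b := by
    intro a b
    rw [← Matrix.mul_diagonal, hgt, Matrix.diagonal_mul]
  have hdet : g.1.det ≠ 0 := (Matrix.isUnit_iff_isUnit_det _).1 g.isUnit |>.ne_zero
  generalize g.1 = M at *
  have e : ∀ a b, M a b ≠ 0 → ![1, i, -1] b = ![u, u * w, u * w ^ 2] a := by
    intro a b hab
    exact mul_left_cancel₀ hab (by rw [hent, mul_comm])
  have hzero : ∀ a b, ![1, i, -1] b ≠ ![u, u * w, u * w ^ 2] a → M a b = 0 := fun a b hab =>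
    by_contra fun hc => hab (e a b hc)
  -- some term of the Leibniz expansion of the determinant does not vanish
  have hsix : (M 0 0 ≠ 0 ∧ M 1 1 ≠ 0 ∧ M 2 2 ≠ 0) ∨ (M 0 2 ≠ 0 ∧ M 1 1 ≠ 0 ∧ M 2 0 ≠ 0) ∨
      (M 0 0 ≠ 0 ∧ M 1 2 ≠ 0 ∧ M 2 1 ≠ 0) ∨ (M 0 1 ≠ 0 ∧ M 1 0 ≠ 0 ∧ M 2 2 ≠ 0) ∨
      (M 0 1 ≠ 0 ∧ M 1 2 ≠ 0 ∧ M 2 0 ≠ 0) ∨ (M 0 2 ≠ 0 ∧ M 1 0 ≠ 0 ∧ M 2 1 ≠ 0) := by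
    by_contra hc
    simp only [← mul_ne_zero_iff, not_or, not_not] at hc
    obtain ⟨c1, c2, c3, c4, c5, c6⟩ := hc
    refine hdet ?_
    rw [Matrix.det_fin_three]
    linear_combination c1 - c2 - c3 - c4 + c5 + c6
  have hinj : ∀ a b, ![1, i, -1] a = ![1, i, -1] b → a = b := by
    intro a b
    fin_cases a <;> fin_cases b <;>
      simp [hi1, him, h11, hi1.symm, him.symm, h11.symm]
  -- the eigenvalues met along a permutation are in geometric progression
  have hrel : ∀ a b c, M 0 a ≠ 0 ∧ M 1 b ≠ 0 ∧ M 2 c ≠ 0 →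
      ![1, i, -1] b ^ 2 = ![1, i, -1] a * ![1, i, -1] c ∧
        ![u, u * w, u * w ^ 2] = ![![1, i, -1] a, ![1, i, -1] b, ![1, i, -1] c] := by
    intro a b c h
    rw [e _ _ h.1, e _ _ h.2.1, e _ _ h.2.2]
    simp
    ring
  rcases hsix with h | h | h | h | h | h
  · refine ⟨_, _, _, h.1, h.2.1, h.2.2, Or.inl ?_⟩
    have h' := (hrel _ _ _ h).2
    have hz : ∀ a b, b ≠ a → M a b = 0 := fun a b hab => hzero a b fun hc => hab <| by
      rw [h'] at hc
      refine hinj _ _ (hc.trans ?_)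
      fin_cases a <;> rfl
    ext a b
    fin_cases a <;> fin_cases b <;> first | rfl | exact hz _ _ (by decide)
  · refine ⟨_, _, _, h.1, h.2.1, h.2.2, Or.inr ?_⟩
    have h' := (hrel _ _ _ h).2
    have hz : ∀ a b, b ≠ Fin.rev a → M a b = 0 := fun a b hab => hzero a b fun hc => hab <| by
      rw [h'] at hc
      refine hinj _ _ (hc.trans ?_)
      fin_cases a <;> rfl
    ext a b
    fin_cases a <;> fin_cases b <;> first | rfl | exact hz _ _ (by decide)
  · exact absurd (hrel _ _ _ h).1 (by simp [hi1.symm])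
  · exact absurd (hrel _ _ _ h).1 (by simpa [eq_comm, neg_eq_iff_eq_neg] using him)
  · exact absurd (hrel _ _ _ h).1 (by simp [hi1.symm])
  · exact absurd (hrel _ _ _ h).1 (by simpa [eq_comm, neg_eq_iff_eq_neg] using him)

end Normalizer

/-! ### Orbits of the normalizer in `SL₃` -/

section Orbits

variable {K : Type*} [Field K]

/-- The orbit of a triple under the diagonal torus of `SL₃`. -/
def torusOrbit (F : Triple K) : Set (Triple K) :=
  {F' | ∃ (g : GL (Fin 3) K) (p : Fin 3 → K),
    g.1 = Matrix.diagonal p ∧ p 0 * p 1 * p 2 = 1 ∧ g • F = F'}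

/-- The involution exchanging `X` and `Z`, with the sign at `Y` that makes its determinant one. -/
def swapSL (K : Type*) [Field K] : SL(3, K) :=
  ⟨antidiagonal ![1, -1, 1], by simp [det_antidiagonal]⟩

/-- The image of `swapSL` in `GL₃`. -/
def swapGL (K : Type*) [Field K] : GL (Fin 3) K := Matrix.SpecialLinearGroup.toGL (swapSL K)

theorem swapGL_coe : (swapGL K).1 = antidiagonal ![1, -1, 1] := rfl

theorem swapGL_mul_self : swapGL K * swapGL K = 1 := by
  refine Units.ext ?_
  rw [Units.val_mul, swapGL_coe]
  ext a b
  fin_cases a <;> fin_cases b <;>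
    simp [antidiagonal, Matrix.mul_apply, Fin.sum_univ_three]

theorem swapGL_smul_smul (F : Triple K) : swapGL K • swapGL K • F = F := by
  rw [← mul_smul, swapGL_mul_self, one_smul]

variable {i : K} (hi : IsPrimitiveRoot i 4)

theorem toPGL_mem_normalizer {A : SL(3, K)}
    (hA : A ∈ Subgroup.normalizer (G4Lift i hi : Set SL(3, K))) :
    Matrix.ProjGenLinGroup.mk (Matrix.SpecialLinearGroup.toGL A) ∈
      Subgroup.normalizer (G4 i hi : Set (PGL(3, K))) := by
  have hmap : (G4Lift i hi).map Matrix.SpecialLinearGroup.toPGL = G4 i hi :=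
    SetLike.coe_injective (bijOn_G4Lift i hi).image_eq
  rw [← hmap]
  exact Subgroup.le_normalizer_map _ ⟨A, hA, rfl⟩

theorem mem_normalizer_of_diagonal {A : SL(3, K)} {p : Fin 3 → K}
    (hA : A.1 = Matrix.diagonal p) :
    A ∈ Subgroup.normalizer (G4Lift i hi : Set SL(3, K)) := by
  refine mem_normalizer_zpowers (Or.inl ?_)
  rw [mul_inv_eq_iff_eq_mul]
  refine Subtype.ext ?_
  rw [Matrix.SpecialLinearGroup.coe_mul, Matrix.SpecialLinearGroup.coe_mul, hA]
  change Matrix.diagonal _ * Matrix.diagonal _ = Matrix.diagonal _ * Matrix.diagonal _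
  rw [Matrix.diagonal_mul_diagonal, Matrix.diagonal_mul_diagonal]
  simp only [mul_comm]

theorem swapSL_mem_normalizer :
    swapSL K ∈ Subgroup.normalizer (G4Lift i hi : Set SL(3, K)) := by
  refine mem_normalizer_zpowers (Or.inr ?_)
  rw [mul_inv_eq_iff_eq_mul, eq_inv_mul_iff_mul_eq]
  refine Subtype.ext ?_
  have hsq := sq_eq_neg_one hi
  rw [Matrix.SpecialLinearGroup.coe_mul, Matrix.SpecialLinearGroup.coe_mul]
  change Matrix.diagonal _ * (antidiagonal _ * Matrix.diagonal _) = antidiagonal _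
  ext a b
  rw [Matrix.diagonal_mul, Matrix.mul_diagonal]
  fin_cases a <;> fin_cases b <;> simp [antidiagonal]
  all_goals linear_combination -hsq

theorem slOrbit_normalizer_eq (F : Triple K) :
    slOrbit (Subgroup.normalizer (G4Lift i hi : Set SL(3, K))) F =
      torusOrbit F ∪ (swapGL K • ·) '' torusOrbit F := by
  ext F'
  constructor
  · rintro ⟨A, hA, rfl⟩
    obtain ⟨p, q, r, -, -, -, h | h⟩ :=
      diagonal_or_antidiagonal_of_mk_mem_normalizer hi (toPGL_mem_normalizer hi hA)
    · have hdet : A.1.det = 1 := A.2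
      have h' : A.1 = _ := h
      rw [h', Matrix.det_diagonal, Fin.prod_univ_three] at hdet
      exact Or.inl ⟨_, _, h, hdet, rfl⟩
    · have hdet : A.1.det = 1 := A.2
      have h' : A.1 = _ := h
      rw [h', det_antidiagonal] at hdet
      refine Or.inr ⟨swapGL K • Matrix.SpecialLinearGroup.toGL A • F,
        ⟨swapGL K * Matrix.SpecialLinearGroup.toGL A, ![r, -q, p], ?_, ?_, mul_smul _ _ _⟩,
        swapGL_smul_smul _⟩
      · rw [Units.val_mul, h, swapGL_coe]
        ext a b
        fin_cases a <;> fin_cases b <;>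
          simp [antidiagonal, Matrix.mul_apply, Fin.sum_univ_three]
      · simp at hdet ⊢
        linear_combination hdet
  · have key : ∀ F' ∈ torusOrbit F, ∃ A ∈ Subgroup.normalizer (G4Lift i hi : Set SL(3, K)),
        Matrix.SpecialLinearGroup.toGL A • F = F' := by
      rintro _ ⟨g, p, hg, hp, rfl⟩
      refine ⟨⟨Matrix.diagonal p, by rw [Matrix.det_diagonal, Fin.prod_univ_three, hp]⟩,
        mem_normalizer_of_diagonal hi rfl, ?_⟩
      congr 1
      exact Units.ext hg.symm
    rintro (h | ⟨_, h, rfl⟩)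
    · exact key _ h
    · obtain ⟨A, hA, rfl⟩ := key _ h
      exact ⟨swapSL K * A, mul_mem (swapSL_mem_normalizer hi) hA, by
        rw [map_mul, mul_smul]; rfl⟩

theorem slOrbit_smul (N : Subgroup SL(3, K)) {A : SL(3, K)} (hA : A ∈ N) (F : Triple K) :
    slOrbit N (Matrix.SpecialLinearGroup.toGL A • F) = slOrbit N F := by
  ext F'
  constructor
  · rintro ⟨B, hB, rfl⟩
    exact ⟨B * A, mul_mem hB hA, by rw [map_mul, mul_smul]⟩
  · rintro ⟨B, hB, rfl⟩
    exact ⟨B * A⁻¹, mul_mem hB (inv_mem hA), by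
      rw [map_mul, map_inv, mul_smul, inv_smul_smul]⟩

/-- If the torus orbit is closed, so is the orbit of the normalizer, which is the union of two
translates of it. -/
theorem zariskiClosure_slOrbit_eq {F : Triple K}
    (h : zariskiClosure K (torusOrbit F) ⊆ torusOrbit F) :
    zariskiClosure K (slOrbit (Subgroup.normalizer (G4Lift i hi : Set SL(3, K))) F) =
      slOrbit (Subgroup.normalizer (G4Lift i hi : Set SL(3, K))) F := by
  refine Set.Subset.antisymm ?_ (subset_zariskiClosure _)
  rw [slOrbit_normalizer_eq]
  refine (zariskiClosure_union_subset _ _).trans (Set.union_subset_union h ?_)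
  intro F' hF'
  refine ⟨swapGL K • F', h ?_, swapGL_smul_smul _⟩
  refine map_mem_zariskiClosure
    { toFun := fun x => swapGL K • x
      map_add' := smul_add _
      map_smul' := fun c x => smul_comm _ c x } ?_ hF'
  rintro _ ⟨F'', hF'', rfl⟩
  change swapGL K • swapGL K • F'' ∈ _
  rwa [swapGL_smul_smul]

/-- A triple that the torus can rescale by every nonzero factor is unstable. -/
theorem zero_mem_zariskiClosure_slOrbit [Infinite K] {F : Triple K}
    (h : ∀ t : K, t ≠ 0 → t • F ∈ torusOrbit F) :
    (0 : Triple K) ∈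
      zariskiClosure K (slOrbit (Subgroup.normalizer (G4Lift i hi : Set SL(3, K))) F) := by
  refine zero_mem_zariskiClosure (F := F) fun t ht => ?_
  rw [slOrbit_normalizer_eq]
  exact Or.inl (h t ht)

/-- The stabilizer in `SL₃` of a lift embeds into the automorphism group. -/
theorem finite_stabilizer {F : Triple K} (hF : F ≠ 0)
    (h : Finite (Aut (Projectivization.mk K F hF))) (N : Subgroup SL(3, K)) :
    {A : SL(3, K) | A ∈ N ∧ Matrix.SpecialLinearGroup.toGL A • F = F}.Finite := by
  refine Set.Finite.of_injOn (t := (Aut (Projectivization.mk K F hF) : Set (PGL(3, K))))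
    (f := fun A => Matrix.ProjGenLinGroup.mk (Matrix.SpecialLinearGroup.toGL A)) ?_ ?_
    (Set.toFinite _)
  · rintro A ⟨-, hA⟩
    exact (mem_aut_mk_iff hF _).2 ⟨_, rfl, hA⟩
  · rintro A ⟨-, hA⟩ B ⟨-, hB⟩ hAB
    have := eq_of_mk_eq_of_smul_eq hF hAB hA hB
    exact Subtype.ext (congrArg Units.val this)

end Orbits

/-! ### Two families of triples -/

section Shapes

variable {K : Type*} [Field K]

/-- The triple `(aX² + bZ², cXY, dY² + eXZ)`. -/
def diagShape (a b c d e : K) : Triple K :=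
  ofCoeffs ![![a, 0, b, 0, 0, 0], ![0, 0, 0, c, 0, 0], ![0, d, 0, 0, e, 0]]

/-- The triple `(aYZ, bX² + cZ², dXY)`. -/
def crossShape (a b c d : K) : Triple K :=
  ofCoeffs ![![0, 0, 0, 0, 0, a], ![b, 0, c, 0, 0, 0], ![0, 0, 0, d, 0, 0]]

theorem forall_coeff_iff {P : Fin 3 → Fin 6 → Prop} :
    (∀ j m, P j m) ↔ (P 0 0 ∧ P 0 1 ∧ P 0 2 ∧ P 0 3 ∧ P 0 4 ∧ P 0 5) ∧
      (P 1 0 ∧ P 1 1 ∧ P 1 2 ∧ P 1 3 ∧ P 1 4 ∧ P 1 5) ∧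
      (P 2 0 ∧ P 2 1 ∧ P 2 2 ∧ P 2 3 ∧ P 2 4 ∧ P 2 5) := by
  constructor
  · intro h
    simp [h]
  · rintro ⟨⟨_, _, _, _, _, _⟩, ⟨_, _, _, _, _, _⟩, _, _, _, _, _, _⟩ j m
    fin_cases j <;> fin_cases m <;> assumption

theorem diagonal_smul_diagShape_iff [Infinite K] {g : GL (Fin 3) K} {p q r : K}
    (hg : g.1 = Matrix.diagonal ![p, q, r]) (a b c d e a' b' c' d' e' : K) :
    g • diagShape a b c d e = diagShape a' b' c' d' e' ↔
      (p * a = a' * p ^ 2 ∧ p * b = b' * r ^ 2) ∧ q * c = c' * (p * q) ∧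
        r * d = d' * q ^ 2 ∧ r * e = e' * (p * r) := by
  rw [diagShape, diagShape, diagonal_smul_ofCoeffs_iff hg, forall_coeff_iff]
  simp [monom]

theorem diagonal_smul_crossShape_iff [Infinite K] {g : GL (Fin 3) K} {p q r : K}
    (hg : g.1 = Matrix.diagonal ![p, q, r]) (a b c d a' b' c' d' : K) :
    g • crossShape a b c d = crossShape a' b' c' d' ↔
      p * a = a' * (q * r) ∧ (q * b = b' * p ^ 2 ∧ q * c = c' * r ^ 2) ∧
        r * d = d' * (p * q) := by
  rw [crossShape, crossShape, diagonal_smul_ofCoeffs_iff hg, forall_coeff_iff]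
  simp [monom]

theorem antidiagonal_smul_crossShape_iff [Infinite K] {g : GL (Fin 3) K} {p q r : K}
    (hg : g.1 = antidiagonal ![p, q, r]) (a b c d a' b' c' d' : K) :
    g • crossShape a b c d = crossShape a' b' c' d' ↔
      p * d = a' * (q * r) ∧ (q * c = b' * p ^ 2 ∧ q * b = c' * r ^ 2) ∧
        r * a = d' * (p * q) := by
  rw [crossShape, crossShape, antidiagonal_smul_ofCoeffs_iff hg, forall_coeff_iff]
  simp [monom, revMonom, Fin.rev]

end Shapes

/-! ### Closedness of torus orbits -/

section Closed

variable {K : Type*} [Field K] [Infinite K]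

omit [Infinite K] in
theorem eval_coeffDual_eq_zero_of_mem_zariskiClosure (P : MvPolynomial (Fin 3 × Fin 6) K)
    {S : Set (Triple K)}
    (hP : ∀ s ∈ S, MvPolynomial.eval (fun k => coeffDual k.1 k.2 s) P = 0)
    {F : Triple K} (hF : F ∈ zariskiClosure K S) :
    MvPolynomial.eval (fun k => coeffDual k.1 k.2 F) P = 0 :=
  eval_eq_zero_of_mem_zariskiClosure (fun k : Fin 3 × Fin 6 => coeffDual k.1 k.2) P hP hF

omit [Infinite K] in
theorem diagonal_ne_zero_of_mul_eq_one {p q r : K} (h : p * q * r = 1) :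
    p ≠ 0 ∧ q ≠ 0 ∧ r ≠ 0 := by
  refine ⟨?_, ?_, ?_⟩ <;> rintro rfl <;> simp at h

theorem mem_torusOrbit_diagShape_iff (a b c d e : K) (F : Triple K) :
    F ∈ torusOrbit (diagShape a b c d e) ↔ ∃ p q r : K, p * q * r = 1 ∧
      F = diagShape (a / p) (b * p / r ^ 2) (c / p) (d * r / q ^ 2) (e / p) := by
  have key : ∀ p q r : K, p * q * r = 1 → ∀ g : GL (Fin 3) K, g.1 = Matrix.diagonal ![p, q, r] →
      g • diagShape a b c d e =
        diagShape (a / p) (b * p / r ^ 2) (c / p) (d * r / q ^ 2) (e / p) := by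
    intro p q r h g hg
    obtain ⟨hp, hq, hr⟩ := diagonal_ne_zero_of_mul_eq_one h
    rw [diagonal_smul_diagShape_iff hg]
    refine ⟨⟨?_, ?_⟩, ?_, ?_, ?_⟩ <;> field_simp
  constructor
  · rintro ⟨g, p, hg, hp, rfl⟩
    refine ⟨p 0, p 1, p 2, hp, key _ _ _ hp _ ?_⟩
    rw [hg]
    congr 1
    funext j
    fin_cases j <;> rfl
  · rintro ⟨p, q, r, h, rfl⟩
    obtain ⟨hp, hq, hr⟩ := diagonal_ne_zero_of_mul_eq_one h
    obtain ⟨g, hg⟩ := exists_gl_diagonal hp hq hr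
    exact ⟨g, _, hg, h, key _ _ _ h _ hg⟩

theorem mem_torusOrbit_crossShape_iff (a b c d : K) (F : Triple K) :
    F ∈ torusOrbit (crossShape a b c d) ↔ ∃ p q r : K, p * q * r = 1 ∧
      F = crossShape (p * a / (q * r)) (q * b / p ^ 2) (q * c / r ^ 2) (r * d / (p * q)) := by
  have key : ∀ p q r : K, p * q * r = 1 → ∀ g : GL (Fin 3) K, g.1 = Matrix.diagonal ![p, q, r] →
      g • crossShape a b c d =
        crossShape (p * a / (q * r)) (q * b / p ^ 2) (q * c / r ^ 2) (r * d / (p * q)) := by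
    intro p q r h g hg
    obtain ⟨hp, hq, hr⟩ := diagonal_ne_zero_of_mul_eq_one h
    rw [diagonal_smul_crossShape_iff hg]
    refine ⟨?_, ⟨?_, ?_⟩, ?_⟩ <;> field_simp
  constructor
  · rintro ⟨g, p, hg, hp, rfl⟩
    refine ⟨p 0, p 1, p 2, hp, key _ _ _ hp _ ?_⟩
    rw [hg]
    congr 1
    funext j
    fin_cases j <;> rfl
  · rintro ⟨p, q, r, h, rfl⟩
    obtain ⟨hp, hq, hr⟩ := diagonal_ne_zero_of_mul_eq_one h
    obtain ⟨g, hg⟩ := exists_gl_diagonal hp hq hr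
    exact ⟨g, _, hg, h, key _ _ _ h _ hg⟩

/-- The orbit is cut out by the monomial invariant `c⁷b³d²` and the ratios `a : c : e`. -/
theorem zariskiClosure_torusOrbit_diagShape {a b c d e : K} (hb : b ≠ 0) (hc : c ≠ 0)
    (hd : d ≠ 0) :
    zariskiClosure K (torusOrbit (diagShape a b c d e)) ⊆ torusOrbit (diagShape a b c d e) := by
  intro F hF
  have hlin : ∀ j m, (∀ a b c d e : K, coeffDual j m (diagShape a b c d e) = 0) →
      coeffDual j m F = 0 := fun j m h =>
    dual_eq_zero_of_mem_zariskiClosure _ (fun s hs => by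
      obtain ⟨p, q, r, -, rfl⟩ := (mem_torusOrbit_diagShape_iff _ _ _ _ _ _).1 hs
      exact h _ _ _ _ _) hF
  have hshape : F = diagShape (coeffDual 0 0 F) (coeffDual 0 2 F) (coeffDual 1 3 F)
      (coeffDual 2 1 F) (coeffDual 2 4 F) := by
    conv_lhs => rw [← ofCoeffs_coeffDual F]
    rw [diagShape]
    congr 1
    funext j m
    fin_cases j <;> fin_cases m <;> first
      | rfl
      | exact hlin _ _ fun _ _ _ _ _ => by simp [diagShape]
  have hinv := eval_coeffDual_eq_zero_of_mem_zariskiClosure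
    (.X (1, 3) ^ 7 * .X (0, 2) ^ 3 * .X (2, 1) ^ 2 - .C (c ^ 7 * b ^ 3 * d ^ 2)) (fun s hs => by
      obtain ⟨p, q, r, h, rfl⟩ := (mem_torusOrbit_diagShape_iff _ _ _ _ _ _).1 hs
      obtain ⟨hp, hq, hr⟩ := diagonal_ne_zero_of_mul_eq_one h
      have hpqr : p ^ 4 * q ^ 4 * r ^ 4 = 1 := by rw [← mul_pow, ← mul_pow, h, one_pow]
      simp [diagShape]
      field_simp
      linear_combination -c ^ 7 * b ^ 3 * d ^ 2 * hpqr) hF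
  have hac := eval_coeffDual_eq_zero_of_mem_zariskiClosure
    (.X (0, 0) * .C c - .C a * .X (1, 3)) (fun s hs => by
      obtain ⟨p, q, r, h, rfl⟩ := (mem_torusOrbit_diagShape_iff _ _ _ _ _ _).1 hs
      simp [diagShape]
      ring) hF
  have hec := eval_coeffDual_eq_zero_of_mem_zariskiClosure
    (.X (2, 4) * .C c - .C e * .X (1, 3)) (fun s hs => by
      obtain ⟨p, q, r, h, rfl⟩ := (mem_torusOrbit_diagShape_iff _ _ _ _ _ _).1 hs
      simp [diagShape]
      ring) hF
  simp only [map_sub, map_mul, map_pow, MvPolynomial.eval_X, MvPolynomial.eval_C] at hinv hac hec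
  rw [hshape]
  generalize coeffDual 0 0 F = a' at *
  generalize coeffDual 0 2 F = b' at *
  generalize coeffDual 1 3 F = c' at *
  generalize coeffDual 2 1 F = d' at *
  generalize coeffDual 2 4 F = e' at *
  have hinv' : c' ^ 7 * b' ^ 3 * d' ^ 2 = c ^ 7 * b ^ 3 * d ^ 2 := by linear_combination hinv
  have hne : c' ^ 7 * b' ^ 3 * d' ^ 2 ≠ 0 := by
    rw [hinv']
    positivity
  have hc' : c' ≠ 0 := by rintro rfl; simp at hne
  have hb' : b' ≠ 0 := by rintro rfl; simp at hne
  have hd' : d' ≠ 0 := by rintro rfl; simp at hne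
  -- the torus element is a rational function of the coefficients, since `p = c / c'` and
  -- `d' / d = p² r³` while `r² = p b / b'`
  have hr2 : (d' * b' * c' ^ 3 / (d * b * c ^ 3)) ^ 2 = c * b / (c' * b') := by
    field_simp
    linear_combination hinv
  set r := d' * b' * c' ^ 3 / (d * b * c ^ 3) with hr
  have hr0 : r ≠ 0 := by
    rw [hr]
    positivity
  refine (mem_torusOrbit_diagShape_iff _ _ _ _ _ _).2 ⟨c / c', (c / c' * r)⁻¹, r, ?_, ?_⟩
  · field_simp
  · rw [hr2]
    congr 1
    · field_simp
      linear_combination hac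
    · field_simp
    · field_simp
    · rw [inv_pow, div_inv_eq_mul, mul_pow, hr2, hr]
      field_simp
    · field_simp
      linear_combination hec

/-- The orbit is cut out by the monomial invariant `a³b²d` and the ratio `cd : ab`. -/
theorem zariskiClosure_torusOrbit_crossShape [IsAlgClosed K] {a b c d : K} (ha : a ≠ 0)
    (hb : b ≠ 0) (hd : d ≠ 0) :
    zariskiClosure K (torusOrbit (crossShape a b c d)) ⊆ torusOrbit (crossShape a b c d) := by
  intro F hF
  have hlin : ∀ j m, (∀ a b c d : K, coeffDual j m (crossShape a b c d) = 0) →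
      coeffDual j m F = 0 := fun j m h =>
    dual_eq_zero_of_mem_zariskiClosure _ (fun s hs => by
      obtain ⟨p, q, r, -, rfl⟩ := (mem_torusOrbit_crossShape_iff _ _ _ _ _).1 hs
      exact h _ _ _ _) hF
  have hshape : F = crossShape (coeffDual 0 5 F) (coeffDual 1 0 F) (coeffDual 1 2 F)
      (coeffDual 2 3 F) := by
    conv_lhs => rw [← ofCoeffs_coeffDual F]
    rw [crossShape]
    congr 1
    funext j m
    fin_cases j <;> fin_cases m <;> first
      | rfl
      | exact hlin _ _ fun _ _ _ _ => by simp [crossShape]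
  have hinv := eval_coeffDual_eq_zero_of_mem_zariskiClosure
    (.X (0, 5) ^ 3 * .X (1, 0) ^ 2 * .X (2, 3) - .C (a ^ 3 * b ^ 2 * d)) (fun s hs => by
      obtain ⟨p, q, r, h, rfl⟩ := (mem_torusOrbit_crossShape_iff _ _ _ _ _).1 hs
      obtain ⟨hp, hq, hr⟩ := diagonal_ne_zero_of_mul_eq_one h
      have hpqr : p ^ 2 * q ^ 2 * r ^ 2 = 1 := by rw [← mul_pow, ← mul_pow, h, one_pow]
      simp [crossShape]
      field_simp
      linear_combination -a ^ 3 * b ^ 2 * d * hpqr) hF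
  have hbc := eval_coeffDual_eq_zero_of_mem_zariskiClosure
    (.X (1, 2) * .X (2, 3) * .C (a * b) - .C (c * d) * .X (0, 5) * .X (1, 0)) (fun s hs => by
      obtain ⟨p, q, r, h, rfl⟩ := (mem_torusOrbit_crossShape_iff _ _ _ _ _).1 hs
      obtain ⟨hp, hq, hr⟩ := diagonal_ne_zero_of_mul_eq_one h
      simp [crossShape]
      field_simp
      ring) hF
  simp only [map_sub, map_mul, map_pow, MvPolynomial.eval_X, MvPolynomial.eval_C] at hinv hbc
  rw [hshape]
  generalize coeffDual 0 5 F = a' at *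
  generalize coeffDual 1 0 F = b' at *
  generalize coeffDual 1 2 F = c' at *
  generalize coeffDual 2 3 F = d' at *
  have hinv' : a' ^ 3 * b' ^ 2 * d' = a ^ 3 * b ^ 2 * d := by linear_combination hinv
  have hne : a' ^ 3 * b' ^ 2 * d' ≠ 0 := by
    rw [hinv']
    positivity
  have ha' : a' ≠ 0 := by rintro rfl; simp at hne
  have hb' : b' ≠ 0 := by rintro rfl; simp at hne
  have hd' : d' ≠ 0 := by rintro rfl; simp at hne
  -- since `qr = p⁻¹`, the first coefficient is multiplied by `p²`, and then `b' / b = q / p²`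
  -- determines `q`
  obtain ⟨p, hp⟩ := IsAlgClosed.exists_pow_nat_eq (a' / a) (n := 2) (by norm_num)
  have hp0 : p ≠ 0 := by
    rintro rfl
    rw [zero_pow two_ne_zero] at hp
    exact (div_ne_zero ha' ha) hp.symm
  have hpa : a' = p ^ 2 * a := by
    rw [hp]
    field_simp
  subst hpa
  have hd'' : d' * (b' ^ 2 * p ^ 6) = d * b ^ 2 := by
    have : a ^ 3 * (d' * (b' ^ 2 * p ^ 6)) = a ^ 3 * (d * b ^ 2) := by linear_combination hinv
    exact mul_left_cancel₀ (by positivity) this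
  refine (mem_torusOrbit_crossShape_iff _ _ _ _ _).2
    ⟨p, b' * p ^ 2 / b, b / (b' * p ^ 3), ?_, ?_⟩
  · field_simp
  · congr 1
    · field_simp
    · field_simp
    · field_simp
      have : a * d * (c' * b ^ 3) = a * d * (c * (b' ^ 3 * p ^ 8)) := by
        linear_combination (b' ^ 2 * p ^ 6) * hbc - a * b * c' * hd''
      have := mul_left_cancel₀ (mul_ne_zero ha hd) this
      linear_combination this
    · field_simp
      linear_combination hd''

end Closed

/-! ### The eigenspaces of the cyclic group -/

section Classification

variable {K : Type*} [Field K] [Infinite K]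

theorem aeTriple_eq (a e : K) : aeTriple a e = diagShape a 1 1 1 e := by
  refine Triple.ext_eval fun v => funext fun j => ?_
  rw [diagShape, eval_ofCoeffs_apply]
  fin_cases j <;> simp [aeTriple, Triple.eval, Triple.coord_of]
  ring

theorem cTriple_eq (c : K) : cTriple c = crossShape 1 1 c 1 := by
  refine Triple.ext_eval fun v => funext fun j => ?_
  rw [crossShape, eval_ofCoeffs_apply]
  fin_cases j <;> simp [cTriple, Triple.eval, Triple.coord_of]

/-- The triple `(aXY, bXZ + cY², dYZ)`, which commutes with `diag(t, 1, t⁻¹)`. -/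
def weightShape (a b c d : K) : Triple K :=
  ofCoeffs ![![0, 0, 0, a, 0, 0], ![0, c, 0, 0, b, 0], ![0, 0, 0, 0, 0, d]]

/-- The triple `(dY² + eXZ, cYZ, bX² + aZ²)`, the image of `diagShape` under the exchange of `X`
and `Z`. -/
def diagShapeSwap (a b c d e : K) : Triple K :=
  ofCoeffs ![![0, d, 0, 0, e, 0], ![0, 0, 0, 0, 0, c], ![b, 0, a, 0, 0, 0]]

theorem swapGL_smul_diagShapeSwap (a b c d e : K) :
    swapGL K • diagShapeSwap a b c d e = diagShape a b c d e := by
  rw [diagShape, diagShapeSwap, antidiagonal_smul_ofCoeffs_iff swapGL_coe, forall_coeff_iff]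
  simp [monom, revMonom, Fin.rev]

theorem swapGL_smul_crossShape (a b c d : K) :
    swapGL K • crossShape a b c d = crossShape (-d) (-c) (-b) (-a) := by
  rw [antidiagonal_smul_crossShape_iff swapGL_coe]
  simp

variable {i : K} (hi : IsPrimitiveRoot i 4)

/-- A triple whose class is fixed by `G4` is an eigenvector of `tau`, and the four eigenspaces are
spanned by the monomials of the four shapes. -/
theorem shape_of_G4_le_aut {F : Triple K} (hF : F ≠ 0)
    (h : G4 i hi ≤ Aut (Projectivization.mk K F hF)) :
    (∃ a b c d e, F = diagShape a b c d e) ∨ (∃ a b c d, F = crossShape a b c d) ∨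
      (∃ a b c d e, F = diagShapeSwap a b c d e) ∨ (∃ a b c d, F = weightShape a b c d) := by
  obtain ⟨hi0, hi1, him, h11, h2⟩ := ne_of_isPrimitiveRoot_four hi
  have hsq := sq_eq_neg_one hi
  obtain ⟨g, hg, hgF⟩ := (mem_aut_mk_iff hF _).1 (h (Subgroup.mem_zpowers _))
  obtain ⟨u, hu⟩ := Matrix.ProjGenLinGroup.mk_eq_mk_iff.1 hg.symm
  have hg' : g.1 = Matrix.diagonal ![(u : K), u * i, -u] := by
    rw [← hu, Units.val_mul, tau_coe, Matrix.GeneralLinearGroup.coe_scalar, Matrix.scalar_apply,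
      Matrix.diagonal_mul_diagonal]
    congr 1
    funext j
    fin_cases j <;> simp [mul_comm]
  have hu0 := u.ne_zero
  generalize (u : K) = l at *
  obtain ⟨A, rfl⟩ := exists_ofCoeffs F
  have hA := (diagonal_smul_ofCoeffs_iff hg' A A).1 hgF
  have hmon : ∀ m, monom m ![l, l * i, -l] = l ^ 2 * ![1, -1, 1, i, -1, -i] m := by
    intro m
    fin_cases m <;> simp [monom]
    · linear_combination l ^ 2 * hsq
    all_goals ring
  have hrow : ∀ j, ![l, l * i, -l] j = l * ![1, i, -1] j := by
    intro j
    fin_cases j <;> simp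
  have hA' : ∀ j m, A j m * (![1, i, -1] j - l * ![1, -1, 1, i, -1, -i] m) = 0 := by
    intro j m
    have := hA j m
    rw [hmon, hrow] at this
    refine mul_left_cancel₀ hu0 ?_
    linear_combination this
  -- some coefficient does not vanish, so that `l` is a quotient of fourth roots of unity
  have hl : l = 1 ∨ l = i ∨ l = -1 ∨ l = -i := by
    have h4 : l ^ 4 = 1 := by
      obtain ⟨j, m, hjm⟩ : ∃ j m, A j m ≠ 0 := by
        by_contra! hc
        exact hF ((congrArg ofCoeffs (funext fun j => funext (hc j))).trans ofCoeffs_zero)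
      have h := (mul_eq_zero.1 (hA' j m)).resolve_left hjm
      have hi4 : i ^ 4 = 1 := hi.pow_eq_one
      have e1 : ![1, i, -1] j ^ 4 = 1 := by
        fin_cases j <;> simp [hi4, Even.neg_pow (by decide : Even 4)]
      have e2 : ![1, -1, 1, i, -1, -i] m ^ 4 = 1 := by
        fin_cases m <;> simp [hi4, Even.neg_pow (by decide : Even 4)]
      rw [sub_eq_zero.1 h, mul_pow, e2, mul_one] at e1
      exact e1
    have : (l - 1) * ((l - i) * ((l + 1) * (l + i))) = 0 := by
      linear_combination h4 - (l ^ 2 - 1) * hsq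
    simpa [sub_eq_zero, eq_neg_iff_add_eq_zero] using this
  have hz : ∀ j m, ![1, i, -1] j ≠ l * ![1, -1, 1, i, -1, -i] m → A j m = 0 := fun j m hne =>
    (mul_eq_zero.1 (hA' j m)).resolve_right (sub_ne_zero.2 hne)
  have hi1' : -i ≠ 1 := fun h => him (by linear_combination -h)
  have hii : i ≠ -i := fun h =>
    hi0 ((mul_eq_zero.1 (by linear_combination h : 2 * i = 0)).resolve_left h2)
  have hsq' : i * i = -1 := by rw [← hsq, sq]
  rcases hl with rfl | rfl | rfl | rfl
  · refine Or.inl ⟨A 0 0, A 0 2, A 1 3, A 2 1, A 2 4, ?_⟩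
    rw [diagShape]
    congr 1
    funext j m
    fin_cases j <;> fin_cases m <;>
      first
      | rfl
      | exact hz _ _ (by simp [hi1, him, h11, hii, hi1.symm, him.symm, h11.symm, hi1'.symm])
  · refine Or.inr (Or.inl ⟨A 0 5, A 1 0, A 1 2, A 2 3, ?_⟩)
    rw [crossShape]
    congr 1
    funext j m
    fin_cases j <;> fin_cases m <;>
      first
      | rfl
      | exact hz _ _ (by
        simp [hi1, him, h11, hii, hsq', hi1.symm, him.symm, h11.symm, hi1'.symm])
  · refine Or.inr (Or.inr (Or.inl ⟨A 2 2, A 2 0, A 1 5, A 0 1, A 0 4, ?_⟩))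
    rw [diagShapeSwap]
    congr 1
    funext j m
    fin_cases j <;> fin_cases m <;>
      first
      | rfl
      | exact hz _ _ (by simp [hi1, him, h11, hii, hi1.symm, him.symm, h11.symm, hi1'.symm])
  · refine Or.inr (Or.inr (Or.inr ⟨A 0 3, A 1 4, A 1 1, A 2 5, ?_⟩))
    rw [weightShape]
    congr 1
    funext j m
    fin_cases j <;> fin_cases m <;>
      first
      | rfl
      | exact hz _ _ (by
        simp [hi1, him, h11, hii, hsq', hi1.symm, him.symm, h11.symm, hi1'.symm])

theorem infinite_aut_of_injective {F : Triple K} (hF : F ≠ 0)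
    (g : {t : K // t ≠ 0} → GL (Fin 3) K) (hg : ∀ t, g t • F = F) (hinj : Function.Injective g) :
    ¬ Finite (Aut (Projectivization.mk K F hF)) := by
  intro h
  have : Infinite {t : K // t ≠ 0} :=
    (Set.Finite.infinite_compl (Set.finite_singleton (0 : K))).to_subtype
  refine not_injective_infinite_finite (β := Aut (Projectivization.mk K F hF)) (fun t =>
    ⟨Matrix.ProjGenLinGroup.mk (g t), (mem_aut_mk_iff hF _).2 ⟨_, rfl, hg t⟩⟩) fun s t hst => ?_
  exact hinj (eq_of_mk_eq_of_smul_eq hF (congrArg Subtype.val hst) (hg s) (hg t))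

theorem infinite_aut_weightShape {a b c d : K} (hF : weightShape a b c d ≠ 0) :
    ¬ Finite (Aut (Projectivization.mk K (weightShape a b c d) hF)) := by
  choose g hg using fun t : {t : K // t ≠ 0} =>
    exists_gl_diagonal t.2 (one_ne_zero (α := K)) (inv_ne_zero t.2)
  refine infinite_aut_of_injective hF g (fun t => ?_) fun s t hst => ?_
  · have ht := t.2
    rw [weightShape, diagonal_smul_ofCoeffs_iff (hg t), forall_coeff_iff]
    simp [monom, ht, mul_comm]
  · have h := congrArg (fun x : GL (Fin 3) K => x.1 0 0) hst
    simp only [hg] at h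
    exact Subtype.ext (by simpa using h)

end Classification

/-! ### The excluded parameter `c = -1` -/

section ExceptionalParameter

variable {K : Type*} [Field K] [CharZero K]

/-- In the coordinates `X + Z, Y, X - Z` the map `f₋₁` commutes with `diag(t, 1, t⁻¹)`. -/
theorem infinite_aut_crossShape_neg_one (hF : crossShape 1 1 (-1) 1 ≠ (0 : Triple K)) :
    ¬ Finite (Aut (Projectivization.mk K (crossShape 1 1 (-1) 1) hF)) := by
  let M : K → Matrix (Fin 3) (Fin 3) K := fun t =>
    !![(t + t⁻¹) / 2, 0, (t - t⁻¹) / 2; 0, 1, 0; (t - t⁻¹) / 2, 0, (t + t⁻¹) / 2]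
  have hM : ∀ t : {t : K // t ≠ 0}, ∃ g : GL (Fin 3) K, g.1 = M t := fun t =>
    ⟨Matrix.GeneralLinearGroup.mkOfDetNeZero (M t) (by
      have ht := t.2
      rw [Matrix.det_fin_three]
      simp [M]
      field_simp
      ring_nf
      exact mul_ne_zero (pow_ne_zero 2 ht) (by norm_num)), rfl⟩
  choose g hg using hM
  refine infinite_aut_of_injective hF g (fun t => ?_) fun s t hst => ?_
  · have ht := t.2
    refine smul_eq_iff.2 fun v => funext fun j => ?_
    rw [hg, crossShape, eval_ofCoeffs_apply]
    simp only [Matrix.mulVec, dotProduct, Fin.sum_univ_three, eval_ofCoeffs_apply]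
    fin_cases j <;> simp [M] <;> field_simp <;> ring
  · have h0 := congrArg (fun x : GL (Fin 3) K => x.1 0 0) hst
    have h2 := congrArg (fun x : GL (Fin 3) K => x.1 0 2) hst
    simp only [hg, M] at h0 h2
    simp at h0 h2
    exact Subtype.ext (by linear_combination (h0 + h2) / 2)

end ExceptionalParameter

/-! ### Stability and normal forms -/

section NormalForms

variable {K : Type*} [Field K] [IsAlgClosed K]

theorem exists_smul_eq_aeTriple {a b c d e : K} (hb : b ≠ 0) (hc : c ≠ 0) (hd : d ≠ 0) :
    ∃ (a' e' : K) (g : GL (Fin 3) K) (p : Fin 3 → K), g.1 = Matrix.diagonal p ∧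
      g • diagShape a b c d e = aeTriple a' e' := by
  obtain ⟨r, hr⟩ := IsAlgClosed.exists_pow_nat_eq (c * b) (n := 2) (by norm_num)
  have hr0 : r ≠ 0 := by
    rintro rfl
    rw [zero_pow two_ne_zero] at hr
    exact mul_ne_zero hc hb hr.symm
  obtain ⟨q, hq⟩ := IsAlgClosed.exists_pow_nat_eq (r * d) (n := 2) (by norm_num)
  have hq0 : q ≠ 0 := by
    rintro rfl
    rw [zero_pow two_ne_zero] at hq
    exact mul_ne_zero hr0 hd hq.symm
  obtain ⟨g, hg⟩ := exists_gl_diagonal hc hq0 hr0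
  refine ⟨a / c, e / c, g, _, hg, ?_⟩
  rw [aeTriple_eq, diagonal_smul_diagShape_iff hg, hr, hq]
  refine ⟨⟨?_, ?_⟩, ?_, ?_, ?_⟩ <;> field_simp

theorem exists_smul_eq_cTriple {a b c d : K} (ha : a ≠ 0) (hb : b ≠ 0) (hd : d ≠ 0) :
    ∃ (c' : K) (g : GL (Fin 3) K) (p : Fin 3 → K), g.1 = Matrix.diagonal p ∧
      g • crossShape a b c d = cTriple c' := by
  obtain ⟨q, hq⟩ := IsAlgClosed.exists_pow_nat_eq (a * d) (n := 2) (by norm_num)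
  have hq0 : q ≠ 0 := by
    rintro rfl
    rw [zero_pow two_ne_zero] at hq
    exact mul_ne_zero ha hd hq.symm
  obtain ⟨p, hp⟩ := IsAlgClosed.exists_pow_nat_eq (q * b) (n := 2) (by norm_num)
  have hp0 : p ≠ 0 := by
    rintro rfl
    rw [zero_pow two_ne_zero] at hp
    exact mul_ne_zero hq0 hb hp.symm
  have hr0 : p * q / d ≠ 0 := div_ne_zero (mul_ne_zero hp0 hq0) hd
  obtain ⟨g, hg⟩ := exists_gl_diagonal hp0 hq0 hr0
  refine ⟨q * c / (p * q / d) ^ 2, g, _, hg, ?_⟩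
  rw [cTriple_eq, diagonal_smul_crossShape_iff hg]
  refine ⟨?_, ⟨?_, ?_⟩, ?_⟩
  · field_simp
    linear_combination -hq
  · rw [hp, one_mul]
  · field_simp
  · field_simp

variable {i : K} (hi : IsPrimitiveRoot i 4)

theorem torusOrbit_rescales_of_b_eq_zero (a c d e t : K) (ht : t ≠ 0) :
    t • diagShape a 0 c d e ∈ torusOrbit (diagShape a 0 c d e) := by
  refine (mem_torusOrbit_diagShape_iff _ _ _ _ _ _).2 ⟨t⁻¹, 1, t, by field_simp, ?_⟩
  rw [diagShape, diagShape, smul_ofCoeffs]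
  congr 1
  funext j m
  fin_cases j <;> fin_cases m <;> simp [mul_comm]

theorem torusOrbit_rescales_of_d_eq_zero (a b c e t : K) (ht : t ≠ 0) :
    t • diagShape a b c 0 e ∈ torusOrbit (diagShape a b c 0 e) := by
  refine (mem_torusOrbit_diagShape_iff _ _ _ _ _ _).2 ⟨t⁻¹, t ^ 2, t⁻¹, by field_simp, ?_⟩
  rw [diagShape, diagShape, smul_ofCoeffs]
  congr 1
  funext j m
  fin_cases j <;> fin_cases m <;> simp [mul_comm]
  field_simp

/-- By semistability `b` and `d` do not vanish, each of the two being, for a suitable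
one-parameter subgroup, the only coefficient whose weight is not `1`. -/
theorem diagShape_coeff_ne_zero {a b c d e : K}
    (hss : (0 : Triple K) ∉ zariskiClosure K
      (slOrbit (Subgroup.normalizer (G4Lift i hi : Set SL(3, K))) (diagShape a b c d e))) :
    b ≠ 0 ∧ d ≠ 0 := by
  constructor
  · rintro rfl
    exact hss (zero_mem_zariskiClosure_slOrbit hi (torusOrbit_rescales_of_b_eq_zero _ _ _ _))
  · rintro rfl
    exact hss (zero_mem_zariskiClosure_slOrbit hi (torusOrbit_rescales_of_d_eq_zero _ _ _ _))

/-- Up to the exchange of `X` and `Z`, only two shapes remain, with nonvanishing coefficients at the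
monomials that will be normalized. -/
theorem exists_shape {F : Triple K} (hF : F ≠ 0)
    (h : G4 i hi ≤ Aut (Projectivization.mk K F hF))
    (hss : (0 : Triple K) ∉ zariskiClosure K
      (slOrbit (Subgroup.normalizer (G4Lift i hi : Set SL(3, K))) F))
    (hdom : ∀ j, ∃ v, F.eval v j ≠ 0) (hfin : Finite (Aut (Projectivization.mk K F hF))) :
    ∃ A ∈ Subgroup.normalizer (G4Lift i hi : Set SL(3, K)),
      (∃ a b c d e : K, b ≠ 0 ∧ c ≠ 0 ∧ d ≠ 0 ∧
        Matrix.SpecialLinearGroup.toGL A • F = diagShape a b c d e) ∨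
      (∃ a b c d : K, a ≠ 0 ∧ b ≠ 0 ∧ d ≠ 0 ∧
        Matrix.SpecialLinearGroup.toGL A • F = crossShape a b c d) := by
  rcases shape_of_G4_le_aut hi hF h with ⟨a, b, c, d, e, rfl⟩ | ⟨a, b, c, d, rfl⟩ |
    ⟨a, b, c, d, e, rfl⟩ | ⟨a, b, c, d, rfl⟩
  · obtain ⟨hb, hd⟩ := diagShape_coeff_ne_zero hi hss
    obtain ⟨v, hv⟩ := hdom 1
    refine ⟨1, one_mem _, Or.inl ⟨a, b, c, d, e, hb, ?_, hd, by rw [map_one, one_smul]⟩⟩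
    rintro rfl
    simp [diagShape, eval_ofCoeffs_apply] at hv
  · have ha : a ≠ 0 := by
      rintro rfl
      obtain ⟨v, hv⟩ := hdom 0
      simp [crossShape, eval_ofCoeffs_apply] at hv
    have hd : d ≠ 0 := by
      rintro rfl
      obtain ⟨v, hv⟩ := hdom 2
      simp [crossShape, eval_ofCoeffs_apply] at hv
    by_cases hb : b = 0
    · refine ⟨swapSL K, swapSL_mem_normalizer hi, Or.inr ⟨-d, -c, -b, -a, neg_ne_zero.2 hd, ?_,
        neg_ne_zero.2 ha, swapGL_smul_crossShape _ _ _ _⟩⟩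
      rw [neg_ne_zero]
      rintro rfl
      obtain ⟨v, hv⟩ := hdom 1
      simp [crossShape, eval_ofCoeffs_apply, hb] at hv
    · exact ⟨1, one_mem _, Or.inr ⟨a, b, c, d, ha, hb, hd, by rw [map_one, one_smul]⟩⟩
  · rw [← slOrbit_smul _ (swapSL_mem_normalizer hi)] at hss
    change _ ∉ zariskiClosure K (slOrbit _ (swapGL K • _)) at hss
    rw [swapGL_smul_diagShapeSwap] at hss
    obtain ⟨hb, hd⟩ := diagShape_coeff_ne_zero hi hss
    refine ⟨swapSL K, swapSL_mem_normalizer hi, Or.inl ⟨a, b, c, d, e, hb, ?_, hd,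
      swapGL_smul_diagShapeSwap _ _ _ _ _⟩⟩
    rintro rfl
    obtain ⟨v, hv⟩ := hdom 1
    simp [diagShapeSwap, eval_ofCoeffs_apply] at hv
  · exact absurd hfin (infinite_aut_weightShape hF)

omit [IsAlgClosed K] in
theorem normalizerConj_mk_iff {F F' : Triple K} (hF : F ≠ 0) (hF' : F' ≠ 0) :
    NormalizerConj i hi (Projectivization.mk K F hF) (Projectivization.mk K F' hF') ↔
      ∃ g : GL (Fin 3) K, Matrix.ProjGenLinGroup.mk g ∈
        Subgroup.normalizer (G4 i hi : Set (PGL(3, K))) ∧ g • F = F' := by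
  constructor
  · rintro ⟨φ, hφ, h⟩
    obtain ⟨g, rfl, rfl⟩ := (conj_mk_eq_iff hF hF' φ).1 h
    exact ⟨g⁻¹, by rw [map_inv]; exact inv_mem hφ, inv_smul_smul _ _⟩
  · rintro ⟨g, hg, rfl⟩
    refine ⟨Matrix.ProjGenLinGroup.mk g⁻¹, by rw [map_inv]; exact inv_mem hg,
      (conj_mk_eq_iff hF hF' _).2 ⟨g⁻¹, rfl, inv_smul_smul _ _⟩⟩

theorem stable_and_normalForm [CharZero K] {f : Rat22 K} (hf : f ∈ Rat22G4ss i hi)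
    (hdom : IsDominant f) (hfin : Finite (Aut f)) :
    IsNormalizerStable i hi f ∧
      ((∃ a e : K, NormalizerConj i hi f (fae a e)) ∨
        (∃ c : K, c ≠ -1 ∧ NormalizerConj i hi f (fc c))) := by
  obtain ⟨F, hF, hrep, hmk⟩ : ∃ (F : Triple K) (hF : F ≠ 0), f.rep = F ∧
      f = Projectivization.mk K F hF := ⟨_, f.rep_nonzero, rfl, f.mk_rep.symm⟩
  have hcoord := fun j => hdom.exists_eval_ne_zero j
  obtain ⟨hG, hss⟩ := hf
  rw [IsSemistable, hrep] at hss
  rw [hrep] at hcoord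
  rw [IsNormalizerStable, IsStable, hrep]
  rw [hmk] at hG hfin ⊢
  obtain ⟨A, hA, h⟩ := exists_shape hi hF hG hss hcoord hfin
  have hAmk := toPGL_mem_normalizer hi hA
  rw [← slOrbit_smul _ hA]
  refine ⟨⟨?_, finite_stabilizer hF hfin _⟩, ?_⟩
  · rcases h with ⟨a, b, c, d, e, hb, hc, hd, h⟩ | ⟨a, b, c, d, ha, hb, hd, h⟩ <;> rw [h]
    · exact zariskiClosure_slOrbit_eq hi (zariskiClosure_torusOrbit_diagShape hb hc hd)
    · exact zariskiClosure_slOrbit_eq hi (zariskiClosure_torusOrbit_crossShape ha hb hd)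
  · rcases h with ⟨a, b, c, d, e, hb, hc, hd, h⟩ | ⟨a, b, c, d, ha, hb, hd, h⟩
    · obtain ⟨a', e', g, p, hg, hgF⟩ := exists_smul_eq_aeTriple (a := a) (e := e) hb hc hd
      refine Or.inl ⟨a', e', (normalizerConj_mk_iff hi hF _).2
        ⟨g * Matrix.SpecialLinearGroup.toGL A, ?_, ?_⟩⟩
      · rw [map_mul]
        exact mul_mem (mk_mem_normalizer_of_diagonal hi hg) hAmk
      · rw [mul_smul, h, hgF]
    · obtain ⟨c', g, p, hg, hgF⟩ := exists_smul_eq_cTriple (c := c) ha hb hd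
      have hgA : (g * Matrix.SpecialLinearGroup.toGL A) • F = cTriple c' := by
        rw [mul_smul, h, hgF]
      refine Or.inr ⟨c', ?_, (normalizerConj_mk_iff hi hF _).2
        ⟨g * Matrix.SpecialLinearGroup.toGL A, ?_, hgA⟩⟩
      · rintro rfl
        rw [cTriple_eq] at hgA
        have hne : crossShape 1 1 (-1) 1 ≠ (0 : Triple K) := by
          rw [← cTriple_eq]
          exact cTriple_ne_zero _
        refine infinite_aut_crossShape_neg_one hne (finite_aut_of_smul_eq hF hne
          (g := (g * Matrix.SpecialLinearGroup.toGL A)⁻¹) ?_ hfin)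
        rw [← hgA, inv_smul_smul]
      · rw [map_mul]
        exact mul_mem (mk_mem_normalizer_of_diagonal hi hg) hAmk

end NormalForms

/-! ### Automorphisms and conjugacies of the normal forms -/

section Automorphisms

variable {K : Type*} [Field K]

/-- The coefficients of the forms with coefficients `A` after substitution of the linear forms given
by the rows of `M`; the mixed coefficients come from polarization. -/
def substCoeffs (A : Fin 3 → Fin 6 → K) (M : Matrix (Fin 3) (Fin 3) K) : Fin 3 → Fin 6 → K :=
  fun j =>
    let q : (Fin 3 → K) → K := fun v => ∑ m, A j m * monom m v
    ![q (M.col 0), q (M.col 1), q (M.col 2),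
      q (M.col 0 + M.col 1) - q (M.col 0) - q (M.col 1),
      q (M.col 0 + M.col 2) - q (M.col 0) - q (M.col 2),
      q (M.col 1 + M.col 2) - q (M.col 1) - q (M.col 2)]

theorem eval_ofCoeffs_mulVec (A : Fin 3 → Fin 6 → K) (M : Matrix (Fin 3) (Fin 3) K)
    (v : Fin 3 → K) :
    (ofCoeffs A).eval (Matrix.mulVec M v) = (ofCoeffs (substCoeffs A M)).eval v := by
  funext j
  rw [eval_ofCoeffs_apply, eval_ofCoeffs_apply]
  simp [substCoeffs, Fin.sum_univ_six, monom, Matrix.mulVec, dotProduct, Fin.sum_univ_three]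
  ring

/-- Comparison of the eighteen coefficients of `g ∘ F` and `F' ∘ g`. -/
theorem smul_ofCoeffs_iff [Infinite K] {g : GL (Fin 3) K} (A B : Fin 3 → Fin 6 → K) :
    g • ofCoeffs A = ofCoeffs B ↔ ∀ j m, ∑ k, g.1 j k * A k m = substCoeffs B g.1 j m := by
  have h2 : ∀ v, Matrix.mulVec g.1 ((ofCoeffs A).eval v) =
      (ofCoeffs fun j m => ∑ k, g.1 j k * A k m).eval v := by
    intro v
    funext j
    simp only [Matrix.mulVec, dotProduct, eval_ofCoeffs, Finset.mul_sum, Finset.sum_mul, mul_assoc]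
    exact Finset.sum_comm
  rw [smul_eq_iff]
  simp only [h2, eval_ofCoeffs_mulVec]
  constructor
  · intro h j m
    exact congrFun (congrFun (ofCoeffs_injective (Triple.ext_eval h)) j) m
  · intro h v
    congr 2
    funext j m
    exact h j m

theorem det_eq_zero_of_row {M : Matrix (Fin 3) (Fin 3) K} (j : Fin 3) (h0 : M j 0 = 0)
    (h1 : M j 1 = 0) (h2 : M j 2 = 0) : M.det = 0 :=
  Matrix.det_eq_zero_of_row_eq_zero j fun k => by fin_cases k <;> assumption

theorem det_gl_ne_zero (g : GL (Fin 3) K) : g.1.det ≠ 0 :=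
  ((Matrix.isUnit_iff_isUnit_det _).1 g.isUnit).ne_zero

variable [CharZero K]

/-- The middle row of the coefficient equations gives `r₀ = -q₀²` and, if `q₀ ≠ 0`, also
`a = p₀ = 1 + q₀⁴`, where `pⱼ, qⱼ, rⱼ` are the entries of the `j`-th row of `g`. This contradicts
the equations of the first row. Hence `q₀ = 0`, and the remaining entries follow at once. -/
theorem smul_aeTriple_eq_self {g : GL (Fin 3) K} {a e : K} (h : g • aeTriple a e = aeTriple a e) :
    ∃ q : K, q ^ 4 = 1 ∧ g.1 = Matrix.diagonal ![1, q, q ^ 2] := by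
  have hdet := det_gl_ne_zero g
  rw [aeTriple_eq, diagShape, smul_ofCoeffs_iff, forall_coeff_iff] at h
  generalize g.1 = M at *
  simp [substCoeffs, Fin.sum_univ_six, Fin.sum_univ_three, monom] at h
  have hrow := det_eq_zero_of_row (M := M) 1
  have hM := Matrix.eta_fin_three M
  generalize M 0 0 = p0 at *
  generalize M 0 1 = q0 at *
  generalize M 0 2 = r0 at *
  generalize M 1 0 = p1 at *
  generalize M 1 1 = q1 at *
  generalize M 1 2 = r1 at *
  generalize M 2 0 = p2 at *
  generalize M 2 1 = q2 at *
  generalize M 2 2 = r2 at *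
  obtain ⟨⟨a1, a2, a3, a4, -, a6⟩, ⟨b1, b2, b3, b4, -, b6⟩, -, c2, -⟩ := h
  have hq1 : q1 ≠ 0 := by
    rintro rfl
    have hr1 : r1 = 0 := by rw [b2, mul_zero]
    exact hdet (hrow (by rw [b3, hr1, mul_zero]) rfl hr1)
  have hr0 : r0 = -q0 ^ 2 := by
    refine mul_left_cancel₀ hq1 ?_
    linear_combination -b6 - q0 * b2
  have hp1 : p1 = -q0 ^ 3 * q1 := by rw [b3, b2, hr0]; ring
  have hp0 : p0 = 1 + q0 ^ 4 := by
    refine mul_left_cancel₀ hq1 ?_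
    linear_combination -b4 - q0 * hp1
  have hq0 : q0 = 0 := by
    by_contra hq0
    have ha : a = p0 := by
      have : p1 ≠ 0 := by
        rw [hp1]
        exact mul_ne_zero (neg_ne_zero.2 (pow_ne_zero 3 hq0)) hq1
      refine mul_left_cancel₀ this ?_
      linear_combination b1
    have hqr : q2 * r2 = -(a * q0 * r0) := by
      linear_combination -a6 / 2
    -- eliminating `q₂` and `r₂` from the equations at `Y²`, `Z²` and `YZ` leaves `2 q₀² a = 0`
    have ha0 : a = 0 := by
      have h2 : q2 ^ 2 * r2 ^ 2 = a ^ 2 * q0 ^ 2 * r0 ^ 2 := by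
        rw [← mul_pow, hqr]
        ring
      rw [show q2 ^ 2 = r0 - a * q0 ^ 2 by linear_combination -a2,
        show r2 ^ 2 = p0 - a * r0 ^ 2 by linear_combination -a3, ← ha, hr0] at h2
      have ha' : a = 1 + q0 ^ 4 := ha.trans hp0
      have h3 : (2 * q0 ^ 2) * a = 0 := by
        linear_combination -h2 - q0 ^ 2 * a * (1 - q0 ^ 4) * ha' - a * q0 ^ 6 * ha'
      exact (mul_eq_zero.1 h3).resolve_left
        (mul_ne_zero two_ne_zero (pow_ne_zero 2 hq0))
    have hp2 : p2 = 0 := by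
      refine pow_eq_zero_iff two_ne_zero |>.1 ?_
      rw [ha0] at a1
      linear_combination -a1
    rw [ha0, hp2] at a4
    exact hq0 (by linear_combination a4)
  subst hq0
  have h0 : r0 = 0 := by rw [hr0]; ring
  have h1 : r1 = 0 := by rw [b2]; ring
  have h2 : p1 = 0 := by rw [hp1]; ring
  have h3 : p0 = 1 := by rw [hp0]; ring
  subst h0 h1 h2 h3
  have h4 : p2 = 0 := pow_eq_zero_iff two_ne_zero |>.1 (by linear_combination -a1)
  have h5 : q2 = 0 := pow_eq_zero_iff two_ne_zero |>.1 (by linear_combination -a2)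
  subst h4 h5
  have h6 : r2 = q1 ^ 2 := by rw [c2]; ring
  subst h6
  refine ⟨q1, by linear_combination -a3, ?_⟩
  rw [hM]
  ext a b
  fin_cases a <;> fin_cases b <;> rfl

/-- Let `pⱼ, qⱼ, rⱼ` be the entries of the `j`-th row of `g`. If `q₁ = 0` and `c² ≠ 1`, then the
middle row vanishes. If `q₁ ≠ 0`, then `g` is diagonal or antidiagonal or `c q₁² = -1`, and the last two
cases force `c² = 1`. -/
theorem smul_cTriple_eq_self {g : GL (Fin 3) K} {c : K} (hc : c ≠ 1) (hc' : c ≠ -1)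
    (h : g • cTriple c = cTriple c) :
    ∃ p : K, p ^ 4 = 1 ∧ g.1 = Matrix.diagonal ![p, p * p, p * p ^ 2] := by
  have hdet := det_gl_ne_zero g
  rw [cTriple_eq, crossShape, smul_ofCoeffs_iff, forall_coeff_iff] at h
  generalize g.1 = M at *
  simp [substCoeffs, Fin.sum_univ_six, Fin.sum_univ_three, monom] at h
  have hrow := det_eq_zero_of_row (M := M) 1
  have hcol := det_eq_zero_of_row (M := M.transpose) 1
  rw [Matrix.det_transpose] at hcol
  simp only [Matrix.transpose_apply] at hcol
  have hM := Matrix.eta_fin_three M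
  have hcc : 1 - c ^ 2 ≠ 0 := by
    rw [show 1 - c ^ 2 = (1 - c) * (c + 1) by ring]
    exact mul_ne_zero (sub_ne_zero.2 hc.symm) fun h => hc' (eq_neg_of_add_eq_zero_left h)
  generalize M 0 0 = p0 at *
  generalize M 0 1 = q0 at *
  generalize M 0 2 = r0 at *
  generalize M 1 0 = p1 at *
  generalize M 1 1 = q1 at *
  generalize M 1 2 = r1 at *
  generalize M 2 0 = p2 at *
  generalize M 2 1 = q2 at *
  generalize M 2 2 = r2 at *
  obtain ⟨⟨a1, a2, a3, a4, a5, a6⟩, ⟨b1, b2, b3, b4, b5, b6⟩, c1, c2, c3, c4, c5, c6⟩ := h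
  have hq1 : q1 ≠ 0 := by
    rintro rfl
    have hq2 : q2 ≠ 0 := by
      rintro rfl
      exact hdet (hcol (pow_eq_zero_iff two_ne_zero |>.1 (by linear_combination -b2)) rfl rfl)
    have hne : q2 ^ 2 * (1 - c ^ 2) ≠ 0 := mul_ne_zero (pow_ne_zero 2 hq2) hcc
    have hr1 : r1 = 0 := by
      have hp0 : p0 = r1 * q2 := by linear_combination a6
      have hp2 : p2 = q0 * r1 := by linear_combination c6
      rw [hp0, hp2] at b1
      refine pow_eq_zero_iff two_ne_zero |>.1 (mul_left_cancel₀ hne ?_)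
      linear_combination -b1 + c * r1 ^ 2 * b2
    have hp1 : p1 = 0 := by
      have hr0 : r0 = p1 * q2 := by linear_combination a4
      have hr2 : r2 = q0 * p1 := by linear_combination c4
      rw [hr0, hr2] at b3
      refine pow_eq_zero_iff two_ne_zero |>.1 (mul_left_cancel₀ hne ?_)
      linear_combination -b3 + c * p1 ^ 2 * b2
    exact hdet (hrow hp1 rfl hr1)
  have hq2 : q2 = 0 := a2.resolve_left hq1
  have hq0 : q0 = 0 := c2.resolve_right hq1
  subst hq2 hq0
  have hp1 : p1 = 0 := by linear_combination b6
  have hr1 : r1 = 0 := by linear_combination b4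
  subst hp1 hr1
  have hr0 : r0 = q1 * p2 := by linear_combination a4
  have hp0 : p0 = q1 * r2 := by linear_combination a6
  have hr2 : r2 = p0 * q1 := by linear_combination c4
  have hp2 : p2 = r0 * q1 := by linear_combination c6
  have hprod : p0 * (r0 * (1 + c * q1 ^ 2)) = 0 := by
    rw [hp2, hr2] at b5
    linear_combination -b5 / 2
  have hsq : ∀ x : K, x ≠ 0 → x = q1 ^ 2 * x → q1 ^ 2 = 1 := fun x hx h =>
    mul_right_cancel₀ hx (by rw [one_mul]; exact h.symm)
  -- antidiagonal matrices occur for `c² = 1` only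
  have hp0' : p0 ≠ 0 := by
    rintro rfl
    have hr2' : r2 = 0 := by rw [hr2, zero_mul]
    have hp2' : p2 ≠ 0 := by
      rintro rfl
      exact hq1 (by linear_combination b1)
    have h1 := hsq p2 hp2' (by linear_combination hp2 + q1 * hr0)
    rw [hr2', hr0] at b3
    exact mul_ne_zero hcc hq1 (by linear_combination b1 - c * b3 - c * p2 ^ 2 * h1)
  have h1 := hsq p0 hp0' (by linear_combination hp0 + q1 * hr2)
  have hr0' : r0 = 0 := by
    by_contra hne
    have := (mul_eq_zero.1 ((mul_eq_zero.1 hprod).resolve_left hp0')).resolve_left hne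
    exact hc' (by linear_combination this - c * h1)
  subst hr0'
  have hp2' : p2 = 0 := by rw [hp2, zero_mul]
  subst hp2'
  have hq1' : q1 = p0 * p0 := by linear_combination b1
  have hr2' : r2 = p0 * p0 ^ 2 := by rw [hr2, hq1']; ring
  refine ⟨p0, by rw [hq1'] at h1; linear_combination h1, ?_⟩
  rw [hM, hr2', hq1']
  ext a b
  fin_cases a <;> fin_cases b <;> rfl

variable {i : K} (hi : IsPrimitiveRoot i 4)

theorem aut_fae (a e : K) : Aut (fae a e) = G4 i hi := by
  have hsq := sq_eq_neg_one hi
  refine le_antisymm (fun φ hφ => ?_) (Subgroup.zpowers_le.2 ?_)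
  · obtain ⟨g, rfl, hg⟩ := (mem_aut_mk_iff (aeTriple_ne_zero a e) φ).1 hφ
    obtain ⟨q, hq, hgq⟩ := smul_aeTriple_eq_self hg
    exact (mk_mem_G4_iff hi g).2 ⟨1, q, one_ne_zero, hq, by simpa using hgq⟩
  · refine (mem_aut_mk_iff (aeTriple_ne_zero a e) _).2 ⟨_, rfl, ?_⟩
    rw [aeTriple_eq, diagonal_smul_diagShape_iff (tau_coe hi)]
    simp [hsq, mul_comm]

theorem aut_fc {c : K} (hc : c ≠ 1) (hc' : c ≠ -1) : Aut (fc c) = G4 i hi := by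
  have hsq := sq_eq_neg_one hi
  have hi0 := (ne_of_isPrimitiveRoot_four hi).1
  refine le_antisymm (fun φ hφ => ?_) (Subgroup.zpowers_le.2 ?_)
  · obtain ⟨g, rfl, hg⟩ := (mem_aut_mk_iff (cTriple_ne_zero c) φ).1 hφ
    obtain ⟨p, hp, hgp⟩ := smul_cTriple_eq_self hc hc' hg
    refine (mk_mem_G4_iff hi g).2 ⟨p, p, ?_, hp, hgp⟩
    rintro rfl
    simp at hp
  · refine (mem_aut_mk_iff (cTriple_ne_zero c) _).2
      ⟨tau i hi * Matrix.GeneralLinearGroup.scalar (Fin 3) (Units.mk0 i hi0), by simp, ?_⟩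
    have hcoe : (tau i hi * Matrix.GeneralLinearGroup.scalar (Fin 3) (Units.mk0 i hi0)).1 =
        Matrix.diagonal ![i, -1, -i] := by
      rw [Units.val_mul, tau_coe, Matrix.GeneralLinearGroup.coe_scalar, Matrix.scalar_apply,
        Matrix.diagonal_mul_diagonal]
      congr 1
      funext j
      fin_cases j <;> simp
      linear_combination hsq
    rw [cTriple_eq, diagonal_smul_crossShape_iff hcoe]
    simp [hsq]

theorem normalizerConj_fae_iff (a e a' e' : K) :
    NormalizerConj i hi (fae a e) (fae a' e') ↔ (a, e) = (a', e') := by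
  rw [fae, fae, normalizerConj_mk_iff]
  constructor
  · rintro ⟨g, hg, h⟩
    obtain ⟨p, q, r, hp, hq, hr, hg | hg⟩ := diagonal_or_antidiagonal_of_mk_mem_normalizer hi hg
    · rw [aeTriple_eq, aeTriple_eq, diagonal_smul_diagShape_iff hg] at h
      obtain ⟨⟨h1, -⟩, h2, -, h3⟩ := h
      have hp1 : p = 1 := mul_right_cancel₀ hq (by linear_combination -h2)
      subst hp1
      refine Prod.ext (by linear_combination h1) (mul_left_cancel₀ hr ?_)
      linear_combination h3
    · rw [aeTriple_eq, aeTriple_eq, diagShape, diagShape, antidiagonal_smul_ofCoeffs_iff hg] at h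
      have := h 1 5
      simp [revMonom, Fin.rev, hq] at this
  · intro h
    obtain ⟨rfl, rfl⟩ := Prod.mk.inj h
    exact ⟨1, by rw [map_one]; exact one_mem _, one_smul _ _⟩

theorem normalizerConj_fc_iff [IsAlgClosed K] (c c' : K) :
    NormalizerConj i hi (fc c) (fc c') ↔ c = c' ∨ c * c' = 1 := by
  rw [fc, fc, normalizerConj_mk_iff]
  constructor
  · rintro ⟨g, hg, h⟩
    obtain ⟨p, q, r, hp, hq, hr, hg | hg⟩ := diagonal_or_antidiagonal_of_mk_mem_normalizer hi hg
    · rw [cTriple_eq, cTriple_eq, diagonal_smul_crossShape_iff hg] at h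
      obtain ⟨h1, ⟨h2, h3⟩, h4⟩ := h
      have hq2 : q ^ 2 = 1 := mul_left_cancel₀ hp (by linear_combination -h1 - q * h4)
      have hr : r ^ 2 = q := by
        linear_combination (r + p * q) * h4 - q ^ 2 * h2 + q * hq2
      refine Or.inl (mul_left_cancel₀ hq ?_)
      linear_combination h3 + c' * hr
    · rw [cTriple_eq, cTriple_eq, antidiagonal_smul_crossShape_iff hg] at h
      obtain ⟨h1, ⟨h2, h3⟩, h4⟩ := h
      have hq2 : q ^ 2 = 1 := mul_left_cancel₀ hp (by linear_combination -h1 - q * h4)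
      have hpr : p ^ 2 = r ^ 2 := by
        linear_combination (p + q * r) * h1 + r ^ 2 * hq2
      refine Or.inr (mul_left_cancel₀ hq ?_)
      linear_combination c' * h2 - h3 + c' * hpr
  · rintro (rfl | h)
    · exact ⟨1, by rw [map_one]; exact one_mem _, one_smul _ _⟩
    · have hc : c ≠ 0 := left_ne_zero_of_mul_eq_one h
      obtain ⟨r, hr⟩ := IsAlgClosed.exists_pow_nat_eq c (n := 2) (by norm_num)
      have hr0 : r ≠ 0 := by
        rintro rfl
        exact hc (by rw [← hr]; ring)
      obtain ⟨g, hg⟩ := exists_gl_antidiagonal hr0 one_ne_zero hr0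
      refine ⟨g, mk_mem_normalizer_of_antidiagonal hi hg, ?_⟩
      rw [cTriple_eq, cTriple_eq, antidiagonal_smul_crossShape_iff hg, hr]
      simp [mul_comm c', h]

end Automorphisms

/-! ### The symmetric group acting on `f₁` -/

section SymmetricGroup

variable {K : Type*} [Field K]

/-- The four nonzero fixed points of `(YZ, X² + Z², XY)` on affine 3-space, as columns, where
`i² = -1` and `s² = 1/2`. Their sum is zero. -/
def fixedPts (i s : K) : Matrix (Fin 3) (Fin 4) K :=
  !![s, -s, i * s, -(i * s); 1, 1, -1, -1; s, -s, -(i * s), i * s]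

/-- The rows are linear forms dual to the fixed points: the value of the `j`-th form at the `k`-th
point is `δⱼₖ - 1/4`. -/
def dualForms (i s : K) : Matrix (Fin 4) (Fin 3) K :=
  !![s / 2, 1 / 4, s / 2; -s / 2, 1 / 4, -s / 2; -(i * s) / 2, -1 / 4, i * s / 2;
    i * s / 2, -1 / 4, -(i * s) / 2]

/-- The linear map that sends the `j`-th fixed point to the `σ j`-th. -/
def permMat (i s : K) (σ : Equiv.Perm (Fin 4)) : Matrix (Fin 3) (Fin 3) K :=
  (fixedPts i s).submatrix id σ * dualForms i s

variable [CharZero K] {i s : K}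

theorem fixedPts_mul_dualForms (hi : i ^ 2 = -1) (hs : 2 * s ^ 2 = 1) :
    fixedPts i s * dualForms i s = 1 := by
  ext a b
  rw [Matrix.mul_apply, Fin.sum_univ_four]
  fin_cases a <;> fin_cases b <;> simp [fixedPts, dualForms]
  all_goals
    first
    | ring1
    | linear_combination hs - s ^ 2 * hi
    | linear_combination s ^ 2 * hi

theorem dualForms_mul_fixedPts (hi : i ^ 2 = -1) (hs : 2 * s ^ 2 = 1) (j k : Fin 4) :
    (dualForms i s * fixedPts i s) j k = (if j = k then 1 else 0) - 1 / 4 := by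
  rw [Matrix.mul_apply, Fin.sum_univ_three]
  have his : 2 * (i ^ 2 * s ^ 2) = -1 := by linear_combination 2 * s ^ 2 * hi - hs
  fin_cases j <;> fin_cases k <;> simp [fixedPts, dualForms]
  all_goals
    first
    | ring1
    | linear_combination hs / 2
    | linear_combination -hs / 2
    | linear_combination his / 2
    | linear_combination -his / 2

omit [CharZero K] in
theorem sum_fixedPts (a : Fin 3) : ∑ j, fixedPts i s a j = 0 := by
  rw [Fin.sum_univ_four]
  fin_cases a <;> simp [fixedPts]

theorem sum_dualForms (b : Fin 3) : ∑ j, dualForms i s j b = 0 := by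
  rw [Fin.sum_univ_four]
  fin_cases b <;> simp [dualForms] <;> ring

theorem permMat_mul_fixedPts (hi : i ^ 2 = -1) (hs : 2 * s ^ 2 = 1) (σ : Equiv.Perm (Fin 4)) :
    permMat i s σ * fixedPts i s = (fixedPts i s).submatrix id σ := by
  ext a k
  rw [permMat, Matrix.mul_assoc, Matrix.mul_apply]
  simp only [dualForms_mul_fixedPts hi hs, Matrix.submatrix_apply, id, mul_sub, mul_ite, mul_one,
    mul_zero, Finset.sum_sub_distrib, Finset.sum_ite_eq', Finset.mem_univ, if_true,
    ← Finset.sum_mul]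
  rw [Equiv.sum_comp σ (fixedPts i s a), sum_fixedPts, zero_mul, sub_zero]

theorem dualForms_mul_permMat (hi : i ^ 2 = -1) (hs : 2 * s ^ 2 = 1) (σ : Equiv.Perm (Fin 4)) :
    dualForms i s * permMat i s σ = (dualForms i s).submatrix σ.symm id := by
  ext j b
  rw [permMat, ← Matrix.mul_assoc, Matrix.mul_apply]
  have h : ∀ k, (dualForms i s * (fixedPts i s).submatrix id σ) j k =
      (if σ.symm j = k then 1 else 0) - 1 / 4 := by
    intro k
    simp only [Equiv.symm_apply_eq]
    exact dualForms_mul_fixedPts hi hs j (σ k)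
  simp only [h, Matrix.submatrix_apply, id, sub_mul, ite_mul, one_mul, zero_mul,
    Finset.sum_sub_distrib, Finset.sum_ite_eq, Finset.mem_univ, if_true, ← Finset.mul_sum]
  rw [sum_dualForms, mul_zero, sub_zero]

/-- The permutation representation of `S₄` on the fixed points. -/
def permHom (hi : i ^ 2 = -1) (hs : 2 * s ^ 2 = 1) : Equiv.Perm (Fin 4) →* GL (Fin 3) K :=
  MonoidHom.toHomUnits
    { toFun := permMat i s
      map_one' := fixedPts_mul_dualForms hi hs
      map_mul' := fun σ τ => by
        have h : (fixedPts i s).submatrix id (σ * τ) =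
            permMat i s σ * (fixedPts i s).submatrix id τ := by
          have h' := congrArg (fun M => Matrix.submatrix M id τ) (permMat_mul_fixedPts hi hs σ)
          exact h'.symm
        change (fixedPts i s).submatrix id (σ * τ) * dualForms i s = _
        rw [h, Matrix.mul_assoc]
        rfl }

theorem permHom_coe (hi : i ^ 2 = -1) (hs : 2 * s ^ 2 = 1) (σ : Equiv.Perm (Fin 4)) :
    (permHom hi hs σ).1 = permMat i s σ := rfl

/-- The map is the sum of the squares of the dual forms along the fixed points, an expression
symmetric in the four points. -/
theorem eval_cTriple_one (hi : i ^ 2 = -1) (hs : 2 * s ^ 2 = 1) (v : Fin 3 → K) :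
    (cTriple (1 : K)).eval v =
      Matrix.mulVec (fixedPts i s) fun j => 2 * (Matrix.mulVec (dualForms i s) v j) ^ 2 := by
  have his : 2 * (i ^ 2 * s ^ 2) = -1 := by linear_combination 2 * s ^ 2 * hi - hs
  funext a
  rw [cTriple_eq, crossShape, eval_ofCoeffs_apply]
  simp only [Matrix.mulVec, dotProduct, Fin.sum_univ_three, Fin.sum_univ_four]
  fin_cases a <;> simp [fixedPts, dualForms]
  · linear_combination -((v 0 + v 2) * v 1 / 2) * hs - (v 0 - v 2) * v 1 / 2 * his
  · linear_combination -((v 0 + v 2) ^ 2 / 2) * hs + (v 0 - v 2) ^ 2 / 2 * his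
  · linear_combination -((v 0 + v 2) * v 1 / 2) * hs + (v 0 - v 2) * v 1 / 2 * his

theorem permHom_smul_cTriple (hi : i ^ 2 = -1) (hs : 2 * s ^ 2 = 1) (σ : Equiv.Perm (Fin 4)) :
    permHom hi hs σ • cTriple (1 : K) = cTriple 1 := by
  refine smul_eq_iff.2 fun v => ?_
  rw [eval_cTriple_one hi hs, eval_cTriple_one hi hs, permHom_coe, Matrix.mulVec_mulVec,
    Matrix.mulVec_mulVec, permMat_mul_fixedPts hi hs, dualForms_mul_permMat hi hs]
  funext a
  simp only [Matrix.mulVec, dotProduct, Matrix.submatrix_apply, id]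
  rw [← Equiv.sum_comp σ fun j => fixedPts i s a j *
    (2 * (∑ b, dualForms i s (σ.symm j) b * v b) ^ 2)]
  simp

theorem fixedPts_col_injective (hi : i ^ 2 = -1) (hs : 2 * s ^ 2 = 1) {j k : Fin 4}
    (h : ∀ a, fixedPts i s a j = fixedPts i s a k) : j = k := by
  have h0 : (dualForms i s * fixedPts i s) j j = (dualForms i s * fixedPts i s) j k := by
    rw [Matrix.mul_apply, Matrix.mul_apply]
    simp only [h]
  rw [dualForms_mul_fixedPts hi hs, dualForms_mul_fixedPts hi hs] at h0
  by_contra hjk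
  simp [hjk] at h0

theorem permHom_injective (hi : i ^ 2 = -1) (hs : 2 * s ^ 2 = 1) :
    Function.Injective (permHom hi hs) := by
  intro σ τ h
  ext k
  refine congrArg Fin.val (fixedPts_col_injective hi hs fun a => ?_)
  have h' : permMat i s σ = permMat i s τ := congrArg Units.val h
  have h2 := (permMat_mul_fixedPts hi hs σ).symm.trans
    ((congrArg (· * fixedPts i s) h').trans (permMat_mul_fixedPts hi hs τ))
  exact congrFun (congrFun h2 a) k

theorem eq_fixedPts_of_eval_eq_self (hi : i ^ 2 = -1) (hs : 2 * s ^ 2 = 1) {v : Fin 3 → K}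
    (hv : v ≠ 0) (h : (cTriple (1 : K)).eval v = v) : ∃ j, ∀ a, v a = fixedPts i s a j := by
  have h0 := congrFun h 0
  have h1 := congrFun h 1
  have h2 := congrFun h 2
  simp [cTriple_eq, crossShape, eval_ofCoeffs_apply] at h0 h1 h2
  have hy : v 1 = 1 ∨ v 1 = -1 := by
    refine sq_eq_one_iff.1 ?_
    by_contra hne
    have hv0 : v 0 = 0 := by
      refine (mul_eq_zero.1 (?_ : (v 1 ^ 2 - 1) * v 0 = 0)).resolve_left (sub_ne_zero.2 hne)
      linear_combination h0 + v 1 * h2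
    have hv2 : v 2 = 0 := by rw [← h2, hv0, zero_mul]
    have hv1 : v 1 = 0 := by rw [← h1, hv0, hv2]; ring
    refine hv (funext fun a => ?_)
    fin_cases a <;> assumption
  rcases hy with hy | hy
  · have h02 : v 2 = v 0 := by rw [← h2, hy, mul_one]
    have h : (v 0 - s) * (v 0 + s) = 0 := by
      rw [h02, hy] at h1
      linear_combination (h1 - hs) / 2
    rcases mul_eq_zero.1 h with h | h
    · refine ⟨0, fun a => ?_⟩
      fin_cases a <;> simp [fixedPts, h02, hy, sub_eq_zero.1 h]
    · refine ⟨1, fun a => ?_⟩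
      fin_cases a <;> simp [fixedPts, h02, hy, eq_neg_of_add_eq_zero_left h]
  · have h02 : v 2 = -v 0 := by rw [← h2, hy, mul_neg_one]
    have h : (v 0 - i * s) * (v 0 + i * s) = 0 := by
      rw [h02, hy] at h1
      linear_combination (h1 + hs) / 2 - s ^ 2 * hi
    rcases mul_eq_zero.1 h with h | h
    · refine ⟨2, fun a => ?_⟩
      fin_cases a <;> simp [fixedPts, h02, hy, sub_eq_zero.1 h]
    · refine ⟨3, fun a => ?_⟩
      fin_cases a <;> simp [fixedPts, h02, hy, eq_neg_of_add_eq_zero_left h]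

theorem eval_fixedPts (hi : i ^ 2 = -1) (hs : 2 * s ^ 2 = 1) (j : Fin 4) :
    (cTriple (1 : K)).eval (fun a => fixedPts i s a j) = fun a => fixedPts i s a j := by
  funext a
  rw [cTriple_eq, crossShape, eval_ofCoeffs_apply]
  fin_cases j <;> fin_cases a <;> simp [fixedPts]
  all_goals
    first
    | linear_combination hs
    | linear_combination 2 * s ^ 2 * hi - hs

/-- A matrix commuting with the map permutes its four nonzero fixed points. -/
theorem exists_permHom_eq (hi : i ^ 2 = -1) (hs : 2 * s ^ 2 = 1) {g : GL (Fin 3) K}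
    (hg : g • cTriple (1 : K) = cTriple 1) : ∃ σ, permHom hi hs σ = g := by
  have hcol : ∀ j, ∃ k, ∀ a, (g.1 * fixedPts i s) a j = fixedPts i s a k := by
    intro j
    refine eq_fixedPts_of_eval_eq_self hi hs (v := Matrix.mulVec g.1 fun a => fixedPts i s a j)
      ?_ ?_
    · intro h0
      have h := Matrix.mulVec_injective_of_isUnit g.isUnit (h0.trans (Matrix.mulVec_zero g.1).symm)
      have h1 := congrFun h 1
      fin_cases j <;> simp [fixedPts] at h1
    · rw [← smul_eq_iff.1 hg, eval_fixedPts hi hs]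
  choose σ hσ using hcol
  have hinj : Function.Injective σ := by
    intro j k hjk
    have h1 : Matrix.mulVec g.1 (fun a => fixedPts i s a j) =
        Matrix.mulVec g.1 fun a => fixedPts i s a k := by
      funext a
      have := hσ k a
      rw [← hjk, ← hσ j a] at this
      exact this.symm
    exact fixedPts_col_injective hi hs (congrFun (Matrix.mulVec_injective_of_isUnit g.isUnit h1))
  refine ⟨Equiv.ofBijective σ (Finite.injective_iff_bijective.1 hinj), Units.ext ?_⟩
  rw [permHom_coe, permMat]
  have h1 : (fixedPts i s).submatrix id (Equiv.ofBijective σ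
      (Finite.injective_iff_bijective.1 hinj)) = g.1 * fixedPts i s := by
    ext a j
    exact (hσ j a).symm
  rw [h1, Matrix.mul_assoc, fixedPts_mul_dualForms hi hs, Matrix.mul_one]

theorem nonempty_aut_fc_one_mulEquiv [IsAlgClosed K] :
    Nonempty (Aut (fc (1 : K)) ≃* Equiv.Perm (Fin 4)) := by
  obtain ⟨i, hi⟩ := IsAlgClosed.exists_pow_nat_eq (-1 : K) (n := 2) (by norm_num)
  obtain ⟨s, hs'⟩ := IsAlgClosed.exists_pow_nat_eq (1 / 2 : K) (n := 2) (by norm_num)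
  have hs : 2 * s ^ 2 = 1 := by
    rw [hs']
    norm_num
  let f : Equiv.Perm (Fin 4) →* Aut (fc (1 : K)) :=
    (Matrix.ProjGenLinGroup.mk.comp (permHom hi hs)).codRestrict _ fun σ =>
      (mem_aut_mk_iff (cTriple_ne_zero 1) _).2 ⟨_, rfl, permHom_smul_cTriple hi hs σ⟩
  refine ⟨(MulEquiv.ofBijective f ⟨fun σ τ h => ?_, fun φ => ?_⟩).symm⟩
  · exact permHom_injective hi hs (eq_of_mk_eq_of_smul_eq (cTriple_ne_zero 1)
      (congrArg Subtype.val h) (permHom_smul_cTriple hi hs σ) (permHom_smul_cTriple hi hs τ))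
  · obtain ⟨g, hg, hg'⟩ := (mem_aut_mk_iff (cTriple_ne_zero 1) _).1 φ.2
    obtain ⟨σ, rfl⟩ := exists_permHom_eq hi hs hg'
    exact ⟨σ, Subtype.ext hg⟩

end SymmetricGroup

end QuadraticMaps

end

theorem proposition17 {K : Type*} [Field K] [IsAlgClosed K] [CharZero K]
    (i : K) (hi : IsPrimitiveRoot i 4) :
    (∀ f : QuadraticMaps.Rat22 K, f ∈ QuadraticMaps.Rat22G4ss i hi →
      QuadraticMaps.IsDominant f → QuadraticMaps.HasDegreeTwo f →
      Finite (QuadraticMaps.Aut f) →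
        QuadraticMaps.IsNormalizerStable i hi f ∧
        ((∃ a e : K, QuadraticMaps.NormalizerConj i hi f (QuadraticMaps.fae a e)) ∨
          (∃ c : K, c ≠ -1 ∧ QuadraticMaps.NormalizerConj i hi f (QuadraticMaps.fc c)))) ∧
    (∀ a e : K, QuadraticMaps.Aut (QuadraticMaps.fae a e) = QuadraticMaps.G4 i hi) ∧
    (∀ a e a' e' : K,
      QuadraticMaps.NormalizerConj i hi (QuadraticMaps.fae a e) (QuadraticMaps.fae a' e') ↔
        (a, e) = (a', e')) ∧
    (∀ c : K, c ≠ 1 → c ≠ -1 →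
      QuadraticMaps.Aut (QuadraticMaps.fc c) = QuadraticMaps.G4 i hi) ∧
    Nonempty (QuadraticMaps.Aut (QuadraticMaps.fc (1 : K)) ≃* Equiv.Perm (Fin 4)) ∧
    (∀ c c' : K, c ≠ -1 → c' ≠ -1 →
      (QuadraticMaps.NormalizerConj i hi (QuadraticMaps.fc c) (QuadraticMaps.fc c') ↔
        c = c' ∨ c * c' = 1)) := by
  refine ⟨fun f hf hdom _ hfin => ?_, fun a e => ?_, fun a e a' e' => ?_, fun c h1 h2 => ?_,
    QuadraticMaps.nonempty_aut_fc_one_mulEquiv, fun c c' _ _ => ?_⟩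
  · exact QuadraticMaps.stable_and_normalForm hi hf hdom hfin
  · exact QuadraticMaps.aut_fae hi a e
  · exact QuadraticMaps.normalizerConj_fae_iff hi a e a' e'
  · exact QuadraticMaps.aut_fc hi h1 h2
  · exact QuadraticMaps.normalizerConj_fc_iff hi c c'
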